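/- Let $n>2$ be an integer, $0<\mu<n$, $0<q<1$, $2^*_\mu=\frac{2n-\mu}{n-2}$, and let $\Omega\subset\mathbb R^n$ be a bounded domain (a nonempty, open, connected, bounded set; in particular every bounded domain with smooth boundary is allowed). Let $H_{+,q}$ be the set of all $u\in H^1_0(\Omega)$ with $u\ge 0$ a.e., $u\not\equiv 0$ and $|u|^{1-q}\in L^1(\Omega)$. For $\lambda>0$, $u\in H^1_0(\Omega)$ put \[ I_\lambda(u)=\frac12\int_\Omega|\nabla u|^2\,dx-\frac{\lambda}{1-q}\int_\Omega|u|^{1-q}\,dx-\frac1{2\cdot 2^*_\mu}\int_\Omega\int_\Omega\frac{|u(x)|^{2^*_\mu}|u(y)|^{2^*_\mu}}{|x-y|^\mu}\,dx\,dy, \] and for $u\in H_{+,q}$ let $\phi_u(t)=I_\lambda(tu)$, $t>0$, be its fiber map. Let \[ S_{H,L}=\inf\left\{\int_{\mathbb R^n}|\nabla u|^2\,dx:\ u\in H^1(\mathbb R^n),\ \int_{\mathbb R^n}\int_{\mathbb R^n}\frac{|u(x)|^{2^*_\mu}|u(y)|^{2^*_\mu}}{|x-y|^\mu}\,dx\,dy=1\right\}.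 \] Let $\Lambda$ be the supremum of the set of all $\lambda>0$ such that (a) for each $u\in H_{+,q}$ the map $\phi_u$ has exactly two critical points in $(0,\infty)$, and (b) $\displaystyle\sup\left\{\int_\Omega|\nabla u|^2\,dx:\ u\in H_{+,q},\ \phi_u'(1)=0,\ \phi_u''(1)>0\right\}\le\left(2^*_\mu\,S_{H,L}^{2^*_\mu}\right)^{\frac1{2^*_\mu-1}}.$ Then this set is nonempty and bounded above, so that $\Lambda$ is a real number, and $\Lambda>0$. -/

import Mathlib

open MeasureTheory Set
open scoped ENNReal ContDiff

noncomputable section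

namespace Choquard

/-- The Euclidean space `ℝⁿ`. -/
abbrev Eucl (n : ℕ) : Type := EuclideanSpace ℝ (Fin n)

/-- `ψ ∈ C_c^∞(Ω)`. -/
structure IsTestFun {n : ℕ} (Ω : Set (Eucl n)) (ψ : Eucl n → ℝ) : Prop where
  smooth : ContDiff ℝ ∞ ψ
  compactSupport : HasCompactSupport ψ
  support_subset : tsupport ψ ⊆ Ω

/-- `g ∈ L²(Ω; ℝⁿ)` is a weak gradient of `u` in `Ω`. -/
structure IsWeakGrad {n : ℕ} (Ω : Set (Eucl n)) (u : Eucl n → ℝ) (g : Eucl n → Eucl n) :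
    Prop where
  memLp : MemLp g 2 (volume.restrict Ω)
  integral_eq : ∀ ψ : Eucl n → ℝ, IsTestFun Ω ψ →
    ∫ x in Ω, u x • gradient ψ x = -∫ x in Ω, ψ x • g x

/-- `u ∈ H¹(Ω)`. Elements of `H¹(Ω)` are represented by functions on `ℝⁿ`; only the almost
everywhere class of the restriction to `Ω` matters below. -/
def MemH1 {n : ℕ} (Ω : Set (Eucl n)) (u : Eucl n → ℝ) : Prop :=
  MemLp u 2 (volume.restrict Ω) ∧ ∃ g, IsWeakGrad Ω u g

open Classical in
/-- The weak gradient of `u` in `Ω` (unique up to null sets when `u ∈ H¹(Ω)`). -/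
def weakGrad {n : ℕ} (Ω : Set (Eucl n)) (u : Eucl n → ℝ) : Eucl n → Eucl n :=
  if h : ∃ g, IsWeakGrad Ω u g then h.choose else 0

/-- `u ∈ H¹₀(Ω)`: `u` lies in the closure of `C_c^∞(Ω)` in `H¹(Ω)`. -/
def MemH10 {n : ℕ} (Ω : Set (Eucl n)) (u : Eucl n → ℝ) : Prop :=
  MemH1 Ω u ∧ ∀ ε : ℝ≥0∞, 0 < ε → ∃ ψ : Eucl n → ℝ, IsTestFun Ω ψ ∧
    eLpNorm (fun x => u x - ψ x) 2 (volume.restrict Ω) < ε ∧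
    eLpNorm (fun x => weakGrad Ω u x - gradient ψ x) 2 (volume.restrict Ω) < ε

/-- `∫_Ω |∇u|² dx`. -/
def dirichlet {n : ℕ} (Ω : Set (Eucl n)) (u : Eucl n → ℝ) : ℝ :=
  ∫ x in Ω, ‖weakGrad Ω u x‖ ^ 2

/-- The critical exponent `2*_μ = (2n - μ)/(n - 2)`. -/
def critExp (n : ℕ) (μ : ℝ) : ℝ := (2 * n - μ) / (n - 2)

/-- `∫_Ω ∫_Ω |u(x)|^{2*_μ} |u(y)|^{2*_μ} / |x - y|^μ dx dy`, as a value in `[0, ∞]`. -/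
def choquard {n : ℕ} (μ : ℝ) (Ω : Set (Eucl n)) (u : Eucl n → ℝ) : ℝ≥0∞ :=
  ∫⁻ x in Ω, ∫⁻ y in Ω,
    ENNReal.ofReal (|u x| ^ critExp n μ * |u y| ^ critExp n μ / ‖x - y‖ ^ μ)

/-- The best constant `S_{H,L}`. -/
def bestConst (n : ℕ) (μ : ℝ) : ℝ :=
  sInf {a | ∃ u : Eucl n → ℝ, MemH1 univ u ∧ choquard μ univ u = 1 ∧ a = dirichlet univ u}

/-- The energy functional `I_λ`. The double integral is finite on `H¹₀(Ω)`. -/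
def energy {n : ℕ} (μ q : ℝ) (Ω : Set (Eucl n)) (l : ℝ) (u : Eucl n → ℝ) : ℝ :=
  1 / 2 * dirichlet Ω u - l / (1 - q) * (∫ x in Ω, |u x| ^ (1 - q))
    - 1 / (2 * critExp n μ) * (choquard μ Ω u).toReal

/-- `u ∈ H_{+,q}`. -/
structure MemHPlus {n : ℕ} (q : ℝ) (Ω : Set (Eucl n)) (u : Eucl n → ℝ) : Prop where
  memH10 : MemH10 Ω u
  nonneg : ∀ᵐ x ∂volume.restrict Ω, 0 ≤ u x
  ne_zero : ¬ ∀ᵐ x ∂volume.restrict Ω, u x = 0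
  integrable : Integrable (fun x => |u x| ^ (1 - q)) (volume.restrict Ω)

/-- The fiber map `φ_u(t) = I_λ(t u)`. -/
def fiber {n : ℕ} (μ q : ℝ) (Ω : Set (Eucl n)) (l : ℝ) (u : Eucl n → ℝ) (t : ℝ) : ℝ :=
  energy μ q Ω l (fun x => t * u x)

/-- The critical points of `φ_u` in `(0, ∞)`. -/
def critPts {n : ℕ} (μ q : ℝ) (Ω : Set (Eucl n)) (l : ℝ) (u : Eucl n → ℝ) : Set ℝ :=
  {t | 0 < t ∧ HasDerivAt (fiber μ q Ω l u) 0 t}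

/-- The functions `u ∈ H_{+,q}` with `φ_u'(1) = 0` and `φ_u''(1) > 0`. -/
def nehariPlus {n : ℕ} (μ q : ℝ) (Ω : Set (Eucl n)) (l : ℝ) : Set (Eucl n → ℝ) :=
  {u | MemHPlus q Ω u ∧ HasDerivAt (fiber μ q Ω l u) 0 1 ∧
    0 < deriv (deriv (fiber μ q Ω l u)) 1}

/-- The set of parameters whose supremum is the threshold `Λ`. The inner supremum is taken in
the extended reals. -/
def admissible {n : ℕ} (μ q : ℝ) (Ω : Set (Eucl n)) : Set ℝ :=
  {l | 0 < l ∧ (∀ u, MemHPlus q Ω u → (critPts μ q Ω l u).encard = 2) ∧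
    sSup ((fun u => (dirichlet Ω u : EReal)) '' nehariPlus μ q Ω l) ≤
      (((critExp n μ * bestConst n μ ^ critExp n μ) ^ (1 / (critExp n μ - 1)) : ℝ) : EReal)}

/-- The threshold `Λ`. -/
def threshold {n : ℕ} (μ q : ℝ) (Ω : Set (Eucl n)) : ℝ := sSup (admissible μ q Ω)

end Choquard

end

/-! For `u ∈ H_{+,q}` put `A = ∫_Ω |∇u|²`, `B = ∫_Ω |u|^{1-q}` and let `C` be the double integral
of `u`. Then `φ_u'(t) = t^{-q} (m(t) - λ B)` with `m(t) = A t^{1+q} - C t^{2·2*_μ-1+q}`. In the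
variable `s = t^{1+q}` the function `m` is strictly concave, so there are two critical points as
soon as `λ B < max m`, and none if `λ B > max m`; a single bump function `u` therefore bounds `λ`
from above.

The Hardy–Littlewood–Sobolev inequality with the Sobolev inequality gives `C ≤ D A^{2*_μ}`, hence
`max m ≥ M A^{(1-q)/2}`, and Hölder with the Sobolev inequality gives `B ≤ E A^{(1-q)/2}`, all
uniformly in `u`: for `λ < M / E` condition (a) holds. If `φ_u'(1) = 0 < φ_u''(1)`, eliminating
`C` gives `A < c λ B ≤ c λ E A^{(1-q)/2}`, so these `A` are uniformly small with `λ`, and (b)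
holds for small `λ` because `S_{H,L} > 0`, by the same two inequalities on `ℝⁿ`. -/

namespace Choquard

open Filter Module Topology
open scoped Convolution NNReal Pointwise

section HardyLittlewoodSobolev

theorem lintegral_lintegral_le_two_mul_of_symm {α : Type*} [MeasurableSpace α] {ν : Measure α}
    [SFinite ν] {k : α → α → ℝ≥0∞} (hk : Measurable (Function.uncurry k))
    (hsymm : ∀ x y, k x y = k y x) {f : α → ℝ≥0∞} (hf : Measurable f) :
    ∫⁻ x, ∫⁻ y, k x y ∂ν ∂ν ≤ 2 * ∫⁻ x, ∫⁻ y in {y | f y ≤ f x}, k x y ∂ν ∂ν := by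
  set k' : α → α → ℝ≥0∞ := fun x => {y | f y ≤ f x}.indicator (k x) with hk'_def
  have hk' : Measurable (Function.uncurry k') :=
    hk.indicator (measurableSet_le (hf.comp measurable_snd) (hf.comp measurable_fst))
  have hle : ∀ x y, k x y ≤ k' x y + k' y x := by
    intro x y
    rcases le_total (f y) (f x) with h | h
    · exact le_add_right (indicator_of_mem (s := {y | f y ≤ f x}) h (k x)).ge
    · exact le_add_left ((hsymm x y).le.trans (indicator_of_mem (s := {x | f x ≤ f y}) h (k y)).ge)
  calc ∫⁻ x, ∫⁻ y, k x y ∂ν ∂ν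
      ≤ ∫⁻ x, ∫⁻ y, (k' x y + k' y x) ∂ν ∂ν :=
        lintegral_mono fun x => lintegral_mono (hle x)
    _ = ∫⁻ x, ∫⁻ y, k' x y ∂ν ∂ν + ∫⁻ x, ∫⁻ y, k' y x ∂ν ∂ν := by
        rw [← lintegral_add_left hk'.lintegral_prod_right]
        exact lintegral_congr fun x => lintegral_add_left (hk'.comp measurable_prodMk_left) _
    _ = 2 * ∫⁻ x, ∫⁻ y, k' x y ∂ν ∂ν := by
        rw [lintegral_lintegral_swap (f := fun x y => k' y x)
          (hk'.comp measurable_swap).aemeasurable, two_mul]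
    _ = 2 * ∫⁻ x, ∫⁻ y in {y | f y ≤ f x}, k x y ∂ν ∂ν := by
        simp_rw [hk'_def, lintegral_indicator (measurableSet_le hf measurable_const)]

variable {E : Type*} [NormedAddCommGroup E] [NormedSpace ℝ E] [FiniteDimensional ℝ E]
  [MeasurableSpace E] [BorelSpace E] (ν : Measure E) [ν.IsAddHaarMeasure]

theorem setLIntegral_smul_enorm_rpow {R : ℝ} (hR : 0 < R) {A : Set E} (hA : MeasurableSet A)
    (s : ℝ) :
    ∫⁻ z in R • A, ‖z‖ₑ ^ s ∂ν =
      ENNReal.ofReal (R ^ (finrank ℝ E + s)) * ∫⁻ z in A, ‖z‖ₑ ^ s ∂ν := by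
  have hkernel : Measurable fun z : E => ‖z‖ₑ ^ s := measurable_enorm.pow_const s
  have hpre : (R • ·) ⁻¹' (R • A) = A := by
    rw [preimage_smul₀ hR.ne', inv_smul_smul₀ hR.ne']
  have hmap : ∫⁻ z in R • A, ‖z‖ₑ ^ s ∂ν.map (R • ·) =
      ENNReal.ofReal (R ^ s) * ∫⁻ z in A, ‖z‖ₑ ^ s ∂ν := by
    rw [setLIntegral_map (hA.const_smul₀ R) hkernel (measurable_const_smul R), hpre,
      ← lintegral_const_mul' _ _ ENNReal.ofReal_ne_top]
    refine lintegral_congr fun z => ?_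
    rw [enorm_smul, ENNReal.mul_rpow_of_ne_top enorm_ne_top enorm_ne_top,
      Real.enorm_of_nonneg hR.le, ENNReal.ofReal_rpow_of_pos hR]
  rw [Measure.map_addHaar_smul ν hR.ne', Measure.restrict_smul, lintegral_smul_measure,
    smul_eq_mul, abs_of_pos (by positivity)] at hmap
  rw [Real.rpow_add hR, Real.rpow_natCast, ENNReal.ofReal_mul (by positivity), mul_assoc, ← hmap,
    ← mul_assoc, ← ENNReal.ofReal_mul (by positivity), mul_inv_cancel₀ (by positivity),
    ENNReal.ofReal_one, one_mul]

theorem setLIntegral_ball_enorm_sub_rpow {R : ℝ} (hR : 0 < R) (x : E) (s : ℝ) :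
    ∫⁻ y in Metric.ball x R, ‖x - y‖ₑ ^ s ∂ν =
      ENNReal.ofReal (R ^ (finrank ℝ E + s)) * ∫⁻ z in Metric.ball 0 1, ‖z‖ₑ ^ s ∂ν := by
  have hball : Metric.ball x R = (x - ·) ⁻¹' (R • Metric.ball (0 : E) 1) := by
    rw [smul_unitBall_of_pos hR]
    ext y
    simp [dist_eq_norm, norm_sub_rev y x]
  rw [← setLIntegral_smul_enorm_rpow ν hR measurableSet_ball, hball]
  exact (Measure.measurePreserving_sub_left ν x).setLIntegral_comp_preimage
    (measurableSet_ball.const_smul₀ R) (measurable_enorm.pow_const s)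

theorem setLIntegral_compl_ball_enorm_sub_rpow {R : ℝ} (hR : 0 < R) (x : E) (s : ℝ) :
    ∫⁻ y in (Metric.ball x R)ᶜ, ‖x - y‖ₑ ^ s ∂ν =
      ENNReal.ofReal (R ^ (finrank ℝ E + s)) * ∫⁻ z in (Metric.ball 0 1)ᶜ, ‖z‖ₑ ^ s ∂ν := by
  have hball : (Metric.ball x R)ᶜ = (x - ·) ⁻¹' (R • (Metric.ball (0 : E) 1)ᶜ) := by
    rw [image_smul.symm, image_compl_eq (MulAction.bijective₀ hR.ne'), image_smul,
      smul_unitBall_of_pos hR]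
    ext y
    simp [dist_eq_norm, norm_sub_rev y x]
  rw [← setLIntegral_smul_enorm_rpow ν hR measurableSet_ball.compl, hball]
  exact (Measure.measurePreserving_sub_left ν x).setLIntegral_comp_preimage
    (measurableSet_ball.compl.const_smul₀ R) (measurable_enorm.pow_const s)

theorem setLIntegral_unitBall_enorm_rpow_lt_top [Nontrivial E] {s : ℝ}
    (hs : -(finrank ℝ E : ℝ) < s) : ∫⁻ z in Metric.ball 0 1, ‖z‖ₑ ^ s ∂ν < ⊤ := by
  have hint : IntegrableOn (fun z : E => ‖z‖ ^ s) (Metric.ball 0 1) ν := by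
    refine integrableOn_ball_of_norm_le_rpow (C := 1) (α := -s) finrank_pos (by linarith)
      (Eventually.of_forall fun z => ?_) (measurable_norm.pow_const s).aestronglyMeasurable
    rw [neg_neg, one_mul, Real.norm_of_nonneg (by positivity)]
  refine lt_of_eq_of_lt (lintegral_congr_ae ?_) hint.2
  filter_upwards [ae_restrict_of_ae (Measure.ae_ne ν 0)] with z hz
  rw [Real.enorm_of_nonneg (by positivity), ← ENNReal.ofReal_rpow_of_pos (norm_pos_iff.2 hz),
    ofReal_norm]

theorem setLIntegral_compl_unitBall_enorm_rpow_lt_top {s : ℝ} (hs : s < -(finrank ℝ E : ℝ)) :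
    ∫⁻ z in (Metric.ball 0 1)ᶜ, ‖z‖ₑ ^ s ∂ν < ⊤ := by
  have hs0 : s ≤ 0 := hs.le.trans (neg_nonpos.2 (Nat.cast_nonneg _))
  have hle : ∀ z ∈ (Metric.ball (0 : E) 1)ᶜ,
      ‖z‖ₑ ^ s ≤ ENNReal.ofReal (2⁻¹ ^ s) * ENNReal.ofReal ((1 + ‖z‖) ^ (-(-s))) := by
    intro z hz
    have hz1 : 1 ≤ ‖z‖ := by simpa using hz
    rw [← ofReal_norm, ENNReal.ofReal_rpow_of_pos (one_pos.trans_le hz1), neg_neg,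
      ← ENNReal.ofReal_mul (by positivity), ← Real.mul_rpow (by positivity) (by positivity)]
    exact ENNReal.ofReal_le_ofReal
      (Real.rpow_le_rpow_of_nonpos (by positivity) (by linarith) hs0)
  calc ∫⁻ z in (Metric.ball 0 1)ᶜ, ‖z‖ₑ ^ s ∂ν
      ≤ ∫⁻ z, ENNReal.ofReal (2⁻¹ ^ s) * ENNReal.ofReal ((1 + ‖z‖) ^ (-(-s))) ∂ν :=
        (setLIntegral_mono' measurableSet_ball.compl hle).trans (setLIntegral_le_lintegral _ _)
    _ = ENNReal.ofReal (2⁻¹ ^ s) * ∫⁻ z, ENNReal.ofReal ((1 + ‖z‖) ^ (-(-s))) ∂ν :=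
        lintegral_const_mul' _ _ ENNReal.ofReal_ne_top
    _ < ⊤ := ENNReal.mul_lt_top ENNReal.ofReal_lt_top
        (finite_integral_one_add_norm (lt_neg_of_lt_neg hs))

theorem setLIntegral_ball_mul_enorm_sub_rpow_le {R : ℝ} (hR : 0 < R) (x : E) (s : ℝ)
    {f : E → ℝ≥0∞} (hf : Measurable f) {a : ℝ≥0∞} (ha : a ≠ ⊤) :
    ∫⁻ y in {y | f y ≤ a} ∩ Metric.ball x R, f y * ‖x - y‖ₑ ^ s ∂ν ≤
      a * (ENNReal.ofReal (R ^ (finrank ℝ E + s)) * ∫⁻ z in Metric.ball 0 1, ‖z‖ₑ ^ s ∂ν) := by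
  calc ∫⁻ y in {y | f y ≤ a} ∩ Metric.ball x R, f y * ‖x - y‖ₑ ^ s ∂ν
      ≤ ∫⁻ y in {y | f y ≤ a} ∩ Metric.ball x R, a * ‖x - y‖ₑ ^ s ∂ν :=
        setLIntegral_mono' ((measurableSet_le hf measurable_const).inter measurableSet_ball)
          fun y hy => mul_le_mul_left hy.1 _
    _ ≤ ∫⁻ y in Metric.ball x R, a * ‖x - y‖ₑ ^ s ∂ν := lintegral_mono_set inter_subset_right
    _ = a * (ENNReal.ofReal (R ^ (finrank ℝ E + s)) *
          ∫⁻ z in Metric.ball 0 1, ‖z‖ₑ ^ s ∂ν) := by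
        rw [lintegral_const_mul' _ _ ha, setLIntegral_ball_enorm_sub_rpow ν hR]

theorem setLIntegral_compl_ball_mul_enorm_sub_rpow_le {R : ℝ} (hR : 0 < R) (x : E) (s : ℝ)
    {p p' : ℝ} (hp : p.HolderConjugate p') {f : E → ℝ≥0∞} (hf : Measurable f) :
    ∫⁻ y in (Metric.ball x R)ᶜ, f y * ‖x - y‖ₑ ^ s ∂ν ≤
      (∫⁻ y, f y ^ p ∂ν) ^ (1 / p) * (ENNReal.ofReal (R ^ (finrank ℝ E + s * p')) *
        ∫⁻ z in (Metric.ball 0 1)ᶜ, ‖z‖ₑ ^ (s * p') ∂ν) ^ (1 / p') := by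
  calc ∫⁻ y in (Metric.ball x R)ᶜ, f y * ‖x - y‖ₑ ^ s ∂ν
      ≤ (∫⁻ y in (Metric.ball x R)ᶜ, f y ^ p ∂ν) ^ (1 / p) *
          (∫⁻ y in (Metric.ball x R)ᶜ, (‖x - y‖ₑ ^ s) ^ p' ∂ν) ^ (1 / p') :=
        ENNReal.lintegral_mul_le_Lp_mul_Lq _ hp hf.aemeasurable
          ((measurable_const.sub measurable_id).enorm.pow_const s).aemeasurable
    _ ≤ (∫⁻ y, f y ^ p ∂ν) ^ (1 / p) *
          (∫⁻ y in (Metric.ball x R)ᶜ, ‖x - y‖ₑ ^ (s * p') ∂ν) ^ (1 / p') := by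
        have := hp.nonneg
        simp_rw [← ENNReal.rpow_mul]
        gcongr ?_ ^ _ * _
        exact setLIntegral_le_lintegral _ _
    _ = _ := by rw [setLIntegral_compl_ball_enorm_sub_rpow ν hR]

variable {μ : ℝ}

theorem holderConjugate_hardyLittlewoodSobolev {d : ℝ} (hμ : 0 < μ) (hμd : μ < d) :
    (2 * d / (2 * d - μ)).HolderConjugate (2 * d / μ) := by
  have hd : 0 < d := hμ.trans hμd
  have hd' : 0 < 2 * d - μ := by linarith
  rw [Real.holderConjugate_iff]
  exact ⟨by rw [lt_div_iff₀ hd']; linarith, by field_simp; ring⟩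

/- Splitting the integral at the radius `R = a ^ (-2 / (2d - μ))` balances the two parts. -/
theorem exists_setLIntegral_mul_enorm_sub_rpow_le (hμ : 0 < μ) (hμd : μ < finrank ℝ E) :
    ∃ C : ℝ≥0, ∀ f : E → ℝ≥0∞, Measurable f →
      ∫⁻ x, f x ^ (2 * finrank ℝ E / (2 * finrank ℝ E - μ)) ∂ν ≤ 1 → ∀ (a : ℝ) (x : E), 0 < a →
      ∫⁻ y in {y | f y ≤ ENNReal.ofReal a}, f y * ‖x - y‖ₑ ^ (-μ) ∂ν ≤
        C * ENNReal.ofReal (a ^ (μ / (2 * finrank ℝ E - μ))) := by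
  have hp := holderConjugate_hardyLittlewoodSobolev hμ hμd
  set d : ℝ := (finrank ℝ E : ℝ)
  have hd : 0 < d := hμ.trans hμd
  have hd' : 0 < 2 * d - μ := by linarith
  have : Nontrivial E := (finrank_pos_iff (R := ℝ)).1 (Nat.cast_pos.1 hd)
  have hnear := setLIntegral_unitBall_enorm_rpow_lt_top ν (neg_lt_neg hμd)
  have hfar := setLIntegral_compl_unitBall_enorm_rpow_lt_top ν (s := -μ * (2 * d / μ))
    (by rw [neg_mul, mul_div_cancel₀ _ hμ.ne']; linarith)
  set C₁ := ∫⁻ z in Metric.ball 0 1, ‖z‖ₑ ^ (-μ) ∂ν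
  set C₂ := ∫⁻ z in (Metric.ball 0 1)ᶜ, ‖z‖ₑ ^ (-μ * (2 * d / μ)) ∂ν
  have hC : C₁ + C₂ ^ (μ / (2 * d)) ≠ ⊤ :=
    ENNReal.add_ne_top.2 ⟨hnear.ne, ENNReal.rpow_ne_top_of_nonneg (by positivity) hfar.ne⟩
  refine ⟨(C₁ + C₂ ^ (μ / (2 * d))).toNNReal, fun f hf hf1 a x ha => ?_⟩
  set R : ℝ := a ^ (-(2 / (2 * d - μ)))
  have hR : 0 < R := by positivity
  have hRnear : a * R ^ (d - μ) = a ^ (μ / (2 * d - μ)) := by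
    rw [← Real.rpow_mul ha.le, ← Real.rpow_one_add' ha.le]
    · congr 1; field_simp; ring
    · have : 1 + -(2 / (2 * d - μ)) * (d - μ) = μ / (2 * d - μ) := by field_simp; ring
      rw [this]; positivity
  have hRfar : (R ^ (d + -μ * (2 * d / μ))) ^ (μ / (2 * d)) = a ^ (μ / (2 * d - μ)) := by
    rw [← Real.rpow_mul hR.le, ← Real.rpow_mul ha.le]
    congr 1; field_simp; ring
  rw [ENNReal.coe_toNNReal hC, add_mul,
    ← lintegral_inter_add_sdiff _ _ (measurableSet_ball (x := x) (ε := R))]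
  refine add_le_add ?_ ((lintegral_mono_set (sdiff_subset_compl _ _)).trans ?_)
  · refine (setLIntegral_ball_mul_enorm_sub_rpow_le ν hR x (-μ) hf
      ENNReal.ofReal_ne_top).trans_eq ?_
    rw [← mul_assoc, ← ENNReal.ofReal_mul ha.le, ← sub_eq_add_neg, hRnear, mul_comm]
  · refine (setLIntegral_compl_ball_mul_enorm_sub_rpow_le ν hR x (-μ) hp hf).trans ?_
    rw [one_div_div (2 * d) μ, ENNReal.mul_rpow_of_nonneg _ _ (by positivity),
      ENNReal.ofReal_rpow_of_nonneg (by positivity) (by positivity), hRfar, mul_comm _ (C₂ ^ _)]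
    exact mul_le_of_le_one_left' (ENNReal.rpow_le_one hf1 (by positivity))

theorem exists_setLIntegral_mul_mul_enorm_sub_rpow_le (hμ : 0 < μ) (hμd : μ < finrank ℝ E) :
    ∃ C : ℝ≥0, ∀ f : E → ℝ≥0∞, Measurable f →
      ∫⁻ x, f x ^ (2 * finrank ℝ E / (2 * finrank ℝ E - μ)) ∂ν ≤ 1 → ∀ x, f x ≠ ⊤ →
      ∫⁻ y in {y | f y ≤ f x}, f x * f y * ‖x - y‖ₑ ^ (-μ) ∂ν ≤
        C * f x ^ (2 * finrank ℝ E / (2 * finrank ℝ E - μ)) := by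
  obtain ⟨C, hC⟩ := exists_setLIntegral_mul_enorm_sub_rpow_le ν hμ hμd
  set d : ℝ := (finrank ℝ E : ℝ)
  have hd' : 0 < 2 * d - μ := by linarith
  refine ⟨C, fun f hf hf1 x hx_top => ?_⟩
  rcases eq_or_ne (f x) 0 with hx0 | hx0
  · simp [hx0]
  have ha : 0 < (f x).toReal := ENNReal.toReal_pos hx0 hx_top
  have h := hC f hf hf1 (f x).toReal x ha
  rw [← ENNReal.ofReal_rpow_of_pos ha, ENNReal.ofReal_toReal hx_top] at h
  calc ∫⁻ y in {y | f y ≤ f x}, f x * f y * ‖x - y‖ₑ ^ (-μ) ∂ν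
      = f x * ∫⁻ y in {y | f y ≤ f x}, f y * ‖x - y‖ₑ ^ (-μ) ∂ν := by
        simp_rw [mul_assoc]
        exact lintegral_const_mul' _ _ hx_top
    _ ≤ f x * (C * f x ^ (μ / (2 * d - μ))) := by gcongr
    _ = C * (f x ^ (1 : ℝ) * f x ^ (μ / (2 * d - μ))) := by
        rw [ENNReal.rpow_one, mul_left_comm]
    _ = C * f x ^ (2 * d / (2 * d - μ)) := by
        rw [← ENNReal.rpow_add _ _ hx0 hx_top]
        congr 2; field_simp; ring

theorem exists_lintegral_lintegral_enorm_sub_rpow_le_of_lintegral_le_one (hμ : 0 < μ)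
    (hμd : μ < finrank ℝ E) :
    ∃ C : ℝ≥0, ∀ f : E → ℝ≥0∞, Measurable f →
      ∫⁻ x, f x ^ (2 * finrank ℝ E / (2 * finrank ℝ E - μ)) ∂ν ≤ 1 →
      ∫⁻ x, ∫⁻ y, f x * f y * ‖x - y‖ₑ ^ (-μ) ∂ν ∂ν ≤ C := by
  obtain ⟨C, hC⟩ := exists_setLIntegral_mul_mul_enorm_sub_rpow_le ν hμ hμd
  set d : ℝ := (finrank ℝ E : ℝ)
  have hp : 0 < 2 * d / (2 * d - μ) := div_pos (by linarith) (by linarith)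
  refine ⟨2 * C, fun f hf hf1 => ?_⟩
  have hkernel : Measurable (Function.uncurry fun x y => f x * f y * ‖x - y‖ₑ ^ (-μ)) :=
    ((hf.comp measurable_fst).mul (hf.comp measurable_snd)).mul
      ((measurable_fst.sub measurable_snd).enorm.pow_const _)
  have hfinite : ∀ᵐ x ∂ν, f x ≠ ⊤ := by
    filter_upwards [ae_lt_top (hf.pow_const _) (hf1.trans_lt ENNReal.one_lt_top).ne] with x hx h
    simp [h, hp] at hx
  calc ∫⁻ x, ∫⁻ y, f x * f y * ‖x - y‖ₑ ^ (-μ) ∂ν ∂ν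
      ≤ 2 * ∫⁻ x, ∫⁻ y in {y | f y ≤ f x}, f x * f y * ‖x - y‖ₑ ^ (-μ) ∂ν ∂ν :=
        lintegral_lintegral_le_two_mul_of_symm hkernel
          (fun x y => by rw [mul_comm (f x), ← enorm_neg, neg_sub]) hf
    _ ≤ 2 * ∫⁻ x, C * f x ^ (2 * d / (2 * d - μ)) ∂ν := by
        gcongr 2 * ?_
        exact lintegral_mono_ae (hfinite.mono (hC f hf hf1))
    _ ≤ 2 * (C * 1) := by
        rw [lintegral_const_mul' _ _ ENNReal.coe_ne_top]
        gcongr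
    _ = (2 * C : ℝ≥0) := by push_cast; rw [mul_one]

theorem exists_hardyLittlewoodSobolev_of_measurable (hμ : 0 < μ) (hμd : μ < finrank ℝ E) :
    ∃ C : ℝ≥0, ∀ f : E → ℝ≥0∞, Measurable f →
      ∫⁻ x, ∫⁻ y, f x * f y * ‖x - y‖ₑ ^ (-μ) ∂ν ∂ν ≤
        C * (∫⁻ x, f x ^ (2 * finrank ℝ E / (2 * finrank ℝ E - μ)) ∂ν) ^
          ((2 * finrank ℝ E - μ) / finrank ℝ E) := by
  obtain ⟨C, hC⟩ := exists_lintegral_lintegral_enorm_sub_rpow_le_of_lintegral_le_one ν hμ hμd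
  set d : ℝ := (finrank ℝ E : ℝ)
  have hd : 0 < d := hμ.trans hμd
  have hd' : 0 < 2 * d - μ := by linarith
  set p := 2 * d / (2 * d - μ)
  have hp : 0 < p := by positivity
  refine ⟨C + 1, fun f hf => ?_⟩
  set N := ∫⁻ x, f x ^ p ∂ν
  rcases eq_or_ne N 0 with hN | hN
  · have hzero : ∀ᵐ x ∂ν, f x = 0 :=
      ((lintegral_eq_zero_iff (hf.pow_const p)).1 hN).mono fun x hx =>
        (ENNReal.rpow_eq_zero_iff_of_pos hp).1 hx
    rw [lintegral_congr_ae (hzero.mono fun x hx => by simp [hx] :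
      (fun x => ∫⁻ y, f x * f y * ‖x - y‖ₑ ^ (-μ) ∂ν) =ᵐ[ν] fun _ => 0), lintegral_zero]
    exact zero_le
  rcases eq_or_ne N ⊤ with hN' | hN'
  · rw [hN', ENNReal.top_rpow_of_pos (by positivity), ENNReal.mul_top (by simp)]
    exact le_top
  have hN_rpow (s : ℝ) : N ^ s ≠ ⊤ := by simp [ENNReal.rpow_eq_top_iff, hN, hN']
  have hnorm : ∫⁻ x, (N ^ (-(1 / p)) * f x) ^ p ∂ν ≤ 1 := by
    simp_rw [ENNReal.mul_rpow_of_nonneg _ _ hp.le, ← ENNReal.rpow_mul]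
    rw [lintegral_const_mul' _ _ (hN_rpow _), neg_mul, one_div_mul_cancel hp.ne',
      ENNReal.rpow_neg_one, ENNReal.inv_mul_cancel hN hN']
  have hscaled := hC _ (hf.const_mul _) hnorm
  have hpull : ∀ x y, N ^ (-(1 / p)) * f x * (N ^ (-(1 / p)) * f y) * ‖x - y‖ₑ ^ (-μ) =
      N ^ (-((2 * d - μ) / d)) * (f x * f y * ‖x - y‖ₑ ^ (-μ)) := fun x y => by
    rw [show -((2 * d - μ) / d) = -(1 / p) + -(1 / p) by simp only [p]; field_simp; ring,
      ENNReal.rpow_add _ _ hN hN']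
    ring
  simp_rw [hpull, lintegral_const_mul' _ _ (hN_rpow _)] at hscaled
  rw [ENNReal.rpow_neg, ENNReal.inv_mul_le_iff (by simp [hN, hN']) (hN_rpow _), mul_comm] at hscaled
  refine hscaled.trans ?_
  gcongr
  exact le_self_add

theorem exists_hardyLittlewoodSobolev (hμ : 0 < μ) (hμd : μ < finrank ℝ E) :
    ∃ C : ℝ≥0, ∀ f : E → ℝ≥0∞, AEMeasurable f ν →
      ∫⁻ x, ∫⁻ y, f x * f y * ‖x - y‖ₑ ^ (-μ) ∂ν ∂ν ≤
        C * (∫⁻ x, f x ^ (2 * finrank ℝ E / (2 * finrank ℝ E - μ)) ∂ν) ^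
          ((2 * finrank ℝ E - μ) / finrank ℝ E) := by
  obtain ⟨C, hC⟩ := exists_hardyLittlewoodSobolev_of_measurable ν hμ hμd
  refine ⟨C, fun f hf => ?_⟩
  have hae := hf.ae_eq_mk
  have henergy : ∫⁻ x, ∫⁻ y, f x * f y * ‖x - y‖ₑ ^ (-μ) ∂ν ∂ν =
      ∫⁻ x, ∫⁻ y, hf.mk f x * hf.mk f y * ‖x - y‖ₑ ^ (-μ) ∂ν ∂ν :=
    lintegral_congr_ae (hae.mono fun x hx =>
      lintegral_congr_ae (hae.mono fun y hy => by simp only [hx, hy]))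
  have hnorm : ∫⁻ x, f x ^ (2 * finrank ℝ E / (2 * finrank ℝ E - μ)) ∂ν =
      ∫⁻ x, hf.mk f x ^ (2 * finrank ℝ E / (2 * finrank ℝ E - μ)) ∂ν :=
    lintegral_congr_ae (hae.mono fun x hx => by simp only [hx])
  rw [henergy, hnorm]
  exact hC _ hf.measurable_mk

end HardyLittlewoodSobolev

section Gradient

variable {F : Type*} [NormedAddCommGroup F] [InnerProductSpace ℝ F] [CompleteSpace F]

theorem norm_gradient (ψ : F → ℝ) (x : F) : ‖gradient ψ x‖ = ‖fderiv ℝ ψ x‖ := by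
  rw [gradient, LinearIsometryEquiv.norm_map]

theorem continuous_gradient {ψ : F → ℝ} (hψ : ContDiff ℝ 1 ψ) : Continuous (gradient ψ) :=
  (LinearIsometryEquiv.continuous _).comp (hψ.continuous_fderiv one_ne_zero)

theorem support_gradient_subset (ψ : F → ℝ) : Function.support (gradient ψ) ⊆ tsupport ψ := by
  refine Subset.trans (fun x hx => ?_) (support_fderiv_subset ℝ)
  rw [Function.mem_support, ← norm_ne_zero_iff] at hx ⊢
  rwa [← norm_gradient]

theorem hasCompactSupport_gradient {ψ : F → ℝ} (hψ : HasCompactSupport ψ) :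
    HasCompactSupport (gradient ψ) :=
  HasCompactSupport.of_support_subset_isCompact hψ (support_gradient_subset ψ)

variable [MeasurableSpace F] [BorelSpace F] [FiniteDimensional ℝ F] {ν : Measure F}
  [ν.IsAddHaarMeasure]

theorem integral_smul_gradient_eq_neg {u ψ : F → ℝ} (hu : ContDiff ℝ 1 u)
    (hu_supp : HasCompactSupport u) (hψ : ContDiff ℝ 1 ψ) (hψ_supp : HasCompactSupport ψ) :
    ∫ x, u x • gradient ψ x ∂ν = -∫ x, ψ x • gradient u x ∂ν := by
  have hu_int : Integrable (fun x => u x • gradient ψ x) ν :=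
    (hu.continuous.smul (continuous_gradient hψ)).integrable_of_hasCompactSupport
      hu_supp.smul_right
  have hψ_int : Integrable (fun x => ψ x • gradient u x) ν :=
    (hψ.continuous.smul (continuous_gradient hu)).integrable_of_hasCompactSupport
      hψ_supp.smul_right
  refine ext_inner_right ℝ fun v => ?_
  have hu_inner : ∀ x, inner ℝ v (u x • gradient ψ x) = u x * fderiv ℝ ψ x v := fun x => by
    rw [inner_smul_right, real_inner_comm, inner_gradient_left]
  have hψ_inner : ∀ x, inner ℝ v (ψ x • gradient u x) = fderiv ℝ u x v * ψ x := fun x => by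
    rw [inner_smul_right, real_inner_comm, inner_gradient_left, mul_comm]
  rw [inner_neg_left, real_inner_comm, real_inner_comm v, ← integral_inner hu_int,
    ← integral_inner hψ_int]
  simp_rw [hu_inner, hψ_inner]
  refine integral_mul_fderiv_eq_neg_fderiv_mul_of_integrable ?_ ?_ ?_
    (fun x _ => (hu.differentiable one_ne_zero).differentiableAt)
    (fun x _ => (hψ.differentiable one_ne_zero).differentiableAt)
  · simp_rw [← hψ_inner]; exact hψ_int.const_inner v
  · simp_rw [← hu_inner]; exact hu_int.const_inner v
  · exact (hu.continuous.mul hψ.continuous).integrable_of_hasCompactSupport hu_supp.mul_right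

end Gradient

section WeakGradient

variable {n : ℕ} {Ω : Set (Eucl n)} {u : Eucl n → ℝ} {g : Eucl n → Eucl n}

theorem isWeakGrad_weakGrad (h : ∃ g, IsWeakGrad Ω u g) : IsWeakGrad Ω u (weakGrad Ω u) := by
  rw [weakGrad, dif_pos h]
  exact h.choose_spec

theorem MemH1.isWeakGrad (hu : MemH1 Ω u) : IsWeakGrad Ω u (weakGrad Ω u) :=
  isWeakGrad_weakGrad hu.2

theorem IsTestFun.contDiff_one (hu : IsTestFun Ω u) : ContDiff ℝ 1 u :=
  hu.smooth.of_le (by exact_mod_cast le_top)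

theorem IsTestFun.eLpNorm_restrict (hu : IsTestFun Ω u) (p : ℝ≥0∞) :
    eLpNorm u p (volume.restrict Ω) = eLpNorm u p volume :=
  eLpNorm_restrict_eq_of_support_subset ((subset_tsupport _).trans hu.support_subset)

theorem IsTestFun.eLpNorm_gradient_restrict (hu : IsTestFun Ω u) (p : ℝ≥0∞) :
    eLpNorm (gradient u) p (volume.restrict Ω) = eLpNorm (gradient u) p volume :=
  eLpNorm_restrict_eq_of_support_subset ((support_gradient_subset _).trans hu.support_subset)

theorem IsWeakGrad.integrable_smul (hg : IsWeakGrad Ω u g) {ψ : Eucl n → ℝ}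
    (hψ : IsTestFun Ω ψ) : Integrable (fun x => ψ x • g x) (volume.restrict Ω) :=
  (hg.memLp.locallyIntegrable one_le_two).integrable_smul_left_of_hasCompactSupport
    hψ.smooth.continuous hψ.compactSupport

theorem IsWeakGrad.ae_eq (hΩ : IsOpen Ω) {g' : Eucl n → Eucl n} (hg : IsWeakGrad Ω u g)
    (hg' : IsWeakGrad Ω u g') : g =ᵐ[volume.restrict Ω] g' := by
  have hloc : LocallyIntegrableOn (fun x => g x - g' x) Ω volume :=
    locallyIntegrableOn_of_locallyIntegrable_restrict
      ((hg.memLp.sub hg'.memLp).locallyIntegrable one_le_two)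
  have hzero : ∀ᵐ x ∂volume, x ∈ Ω → g x - g' x = 0 :=
    hΩ.ae_eq_zero_of_integral_contDiff_smul_eq_zero hloc fun ψ hψ_smooth hψ_supp hψΩ => by
      have hψ : IsTestFun Ω ψ := ⟨hψ_smooth, hψ_supp, hψΩ⟩
      rw [← setIntegral_eq_integral_of_forall_compl_eq_zero (s := Ω)]
      · simp_rw [smul_sub]
        rw [integral_sub (hg.integrable_smul hψ) (hg'.integrable_smul hψ), sub_eq_zero,
          ← neg_inj, ← hg.integral_eq ψ hψ, ← hg'.integral_eq ψ hψ]
      · intro x hx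
        rw [image_eq_zero_of_notMem_tsupport (fun h => hx (hψΩ h)), zero_smul]
  rw [EventuallyEq, ae_restrict_iff' hΩ.measurableSet]
  filter_upwards [hzero] with x hx hxΩ using sub_eq_zero.1 (hx hxΩ)

theorem IsWeakGrad.const_mul (hg : IsWeakGrad Ω u g) (t : ℝ) :
    IsWeakGrad Ω (fun x => t * u x) (fun x => t • g x) where
  memLp := hg.memLp.const_smul t
  integral_eq ψ hψ := by
    simp_rw [mul_smul, fun x => smul_comm (ψ x) t (g x)]
    rw [integral_smul, integral_smul, hg.integral_eq ψ hψ, smul_neg]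

theorem IsTestFun.isWeakGrad (hu : IsTestFun Ω u) : IsWeakGrad Ω u (gradient u) where
  memLp := ((continuous_gradient hu.contDiff_one).memLp_of_hasCompactSupport
    (hasCompactSupport_gradient hu.compactSupport)).restrict _
  integral_eq ψ hψ := by
    rw [setIntegral_eq_integral_of_forall_compl_eq_zero,
      setIntegral_eq_integral_of_forall_compl_eq_zero]
    · exact integral_smul_gradient_eq_neg hu.contDiff_one hu.compactSupport
        hψ.contDiff_one hψ.compactSupport
    · intro x hx
      rw [image_eq_zero_of_notMem_tsupport (fun h => hx (hψ.support_subset h)), zero_smul]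
    · intro x hx
      rw [image_eq_zero_of_notMem_tsupport (fun h => hx (hu.support_subset h)), zero_smul]

theorem IsTestFun.memH1 (hu : IsTestFun Ω u) : MemH1 Ω u :=
  ⟨(hu.smooth.continuous.memLp_of_hasCompactSupport hu.compactSupport).restrict _, _,
    hu.isWeakGrad⟩

theorem IsTestFun.memH10 (hΩ : IsOpen Ω) (hu : IsTestFun Ω u) : MemH10 Ω u := by
  refine ⟨hu.memH1, fun ε hε => ⟨u, hu, by simpa using hε, ?_⟩⟩
  have hzero : (fun x => weakGrad Ω u x - gradient u x) =ᵐ[volume.restrict Ω] 0 :=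
    (hu.memH1.isWeakGrad.ae_eq hΩ hu.isWeakGrad).mono fun x hx => sub_eq_zero.2 hx
  rw [eLpNorm_congr_ae hzero]
  simpa using hε

theorem MemH1.const_mul (hu : MemH1 Ω u) (t : ℝ) : MemH1 Ω (fun x => t * u x) :=
  ⟨hu.1.const_mul t, _, hu.isWeakGrad.const_mul t⟩

theorem dirichlet_const_mul (hΩ : IsOpen Ω) (hu : MemH1 Ω u) (t : ℝ) :
    dirichlet Ω (fun x => t * u x) = t ^ 2 * dirichlet Ω u := by
  have hgrad := (hu.const_mul t).isWeakGrad.ae_eq hΩ (hu.isWeakGrad.const_mul t)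
  rw [dirichlet, dirichlet, ← integral_const_mul]
  refine integral_congr_ae (hgrad.mono fun x hx => ?_)
  simp only [hx, norm_smul, mul_pow, Real.norm_eq_abs, sq_abs]

theorem dirichlet_nonneg (Ω : Set (Eucl n)) (u : Eucl n → ℝ) : 0 ≤ dirichlet Ω u :=
  integral_nonneg fun _ => by positivity

theorem MemH1.eLpNorm_weakGrad (hu : MemH1 Ω u) :
    eLpNorm (weakGrad Ω u) 2 (volume.restrict Ω) =
      ENNReal.ofReal (dirichlet Ω u ^ (1 / 2 : ℝ)) := by
  rw [hu.isWeakGrad.memLp.eLpNorm_eq_integral_rpow_norm two_ne_zero ENNReal.ofNat_ne_top]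
  simp [dirichlet]

end WeakGradient

section Mollification

theorem rpow_lintegral_le_lintegral_rpow {α : Type*} [MeasurableSpace α] {P : Measure α}
    [IsProbabilityMeasure P] {p : ℝ} (hp : 1 ≤ p) {f : α → ℝ≥0∞} (hf : AEMeasurable f P) :
    (∫⁻ x, f x ∂P) ^ p ≤ ∫⁻ x, f x ^ p ∂P := by
  have h := eLpNorm'_le_eLpNorm'_of_exponent_le one_pos hp P hf.aestronglyMeasurable
  simp only [eLpNorm', enorm_eq_self, ENNReal.rpow_one, one_div, inv_one] at h
  exact (ENNReal.le_rpow_inv_iff (one_pos.trans_le hp)).1 h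

theorem lintegral_rpow_lintegral_sub_mul_le {G : Type*} [AddCommGroup G] [MeasurableSpace G]
    [MeasurableAdd₂ G] [MeasurableNeg G] {ν : Measure G} [SFinite ν] [ν.IsAddLeftInvariant]
    [ν.IsNegInvariant] {ρ f : G → ℝ≥0∞} (hρ : Measurable ρ) (hρ_one : ∫⁻ t, ρ t ∂ν = 1)
    (hf : AEMeasurable f ν) {p : ℝ} (hp : 1 ≤ p) :
    ∫⁻ x, (∫⁻ y, ρ (x - y) * f y ∂ν) ^ p ∂ν ≤ ∫⁻ y, f y ^ p ∂ν := by
  have hρx : ∀ x, Measurable fun y => ρ (x - y) := fun x => hρ.comp (measurable_const_sub x)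
  have hjensen : ∀ x, (∫⁻ y, ρ (x - y) * f y ∂ν) ^ p ≤ ∫⁻ y, ρ (x - y) * f y ^ p ∂ν := fun x => by
    have : IsProbabilityMeasure (ν.withDensity fun y => ρ (x - y)) :=
      ⟨by rw [withDensity_apply _ .univ, Measure.restrict_univ, lintegral_sub_left_eq_self, hρ_one]⟩
    have h := rpow_lintegral_le_lintegral_rpow hp
      (hf.mono_ac (withDensity_absolutelyContinuous ν fun y => ρ (x - y)))
    rwa [lintegral_withDensity_eq_lintegral_mul₀ (hρx x).aemeasurable hf,
      lintegral_withDensity_eq_lintegral_mul₀ (hρx x).aemeasurable (hf.pow_const p)] at h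
  calc ∫⁻ x, (∫⁻ y, ρ (x - y) * f y ∂ν) ^ p ∂ν
      ≤ ∫⁻ x, ∫⁻ y, ρ (x - y) * f y ^ p ∂ν ∂ν := lintegral_mono hjensen
    _ = ∫⁻ y, ∫⁻ x, ρ (x - y) * f y ^ p ∂ν ∂ν :=
        lintegral_lintegral_swap ((hρ.comp measurable_sub).aemeasurable.mul
          ((hf.comp_quasiMeasurePreserving Measure.quasiMeasurePreserving_snd).pow_const p))
    _ = ∫⁻ y, f y ^ p ∂ν := by
        refine lintegral_congr fun y => ?_
        rw [lintegral_mul_const (f := fun x => ρ (x - y)) _ (hρ.comp (measurable_sub_const y)),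
          lintegral_sub_right_eq_self ρ y, hρ_one, one_mul]

variable {F V : Type*} [NormedAddCommGroup F] [NormedSpace ℝ F] [FiniteDimensional ℝ F]
  [MeasurableSpace F] [BorelSpace F] {ν : Measure F} [ν.IsAddHaarMeasure] [HasContDiffBump F]
  [NormedAddCommGroup V] [NormedSpace ℝ V]

theorem lintegral_ofReal_normed (φ : ContDiffBump (0 : F)) :
    ∫⁻ t, ENNReal.ofReal (φ.normed ν t) ∂ν = 1 := by
  rw [← ofReal_integral_eq_lintegral_ofReal φ.integrable_normed
    (Eventually.of_forall φ.nonneg_normed), φ.integral_normed, ENNReal.ofReal_one]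

theorem eLpNorm_normed_convolution_le (φ : ContDiffBump (0 : F)) {f : F → V}
    (hf : AEStronglyMeasurable f ν) {p : ℝ≥0∞} (hp : 1 ≤ p) (hp_top : p ≠ ⊤) :
    eLpNorm (φ.normed ν ⋆[ContinuousLinearMap.lsmul ℝ ℝ, ν] f) p ν ≤ eLpNorm f p ν := by
  have hp0 : p ≠ 0 := (one_pos.trans_le hp).ne'
  rw [eLpNorm_eq_lintegral_rpow_enorm_toReal hp0 hp_top,
    eLpNorm_eq_lintegral_rpow_enorm_toReal hp0 hp_top]
  gcongr ?_ ^ _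
  refine le_trans (lintegral_mono fun x => ?_) (lintegral_rpow_lintegral_sub_mul_le
    φ.continuous_normed.measurable.ennreal_ofReal (lintegral_ofReal_normed φ) hf.enorm
    (by simpa using ENNReal.toReal_mono hp_top hp))
  gcongr
  rw [convolution_lsmul_swap]
  refine (enorm_integral_le_lintegral_enorm _).trans_eq (lintegral_congr fun y => ?_)
  rw [enorm_smul, Real.enorm_of_nonneg (φ.nonneg_normed _)]

end Mollification

section Cutoff

variable {F : Type*} [NormedAddCommGroup F]

theorem exists_norm_fderiv_comp_smul_le [NormedSpace ℝ F] {χ : F → ℝ} (hχ : ContDiff ℝ 1 χ)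
    (hχ_supp : HasCompactSupport χ) :
    ∃ M : ℝ, 0 ≤ M ∧ ∀ r : ℝ, 0 ≤ r → ∀ x, ‖fderiv ℝ (fun x => χ (r • x)) x‖ ≤ M * r := by
  obtain ⟨M, hM⟩ := (hχ.continuous_fderiv one_ne_zero).bounded_above_of_compact_support
    (hχ_supp.fderiv ℝ)
  refine ⟨M, (norm_nonneg _).trans (hM 0), fun r hr x => ?_⟩
  rw [fderiv_comp_smul, norm_smul, Real.norm_of_nonneg hr, mul_comm]
  exact mul_le_mul_of_nonneg_right (hM _) hr

theorem exists_cutoff_sequence [NormedSpace ℝ F] [FiniteDimensional ℝ F] :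
    ∃ (c : ℕ → F → ℝ) (ε : ℕ → ℝ≥0), Tendsto ε atTop (𝓝 0) ∧
      (∀ x, ∀ᶠ k in atTop, c k x = 1) ∧ ∀ k, ContDiff ℝ 1 (c k) ∧ HasCompactSupport (c k) ∧
        ∀ x, ‖c k x‖ ≤ 1 ∧ ‖fderiv ℝ (c k) x‖ ≤ ε k := by
  let χ : ContDiffBump (0 : F) := ⟨1, 2, one_pos, one_lt_two⟩
  obtain ⟨M, hM0, hM⟩ := exists_norm_fderiv_comp_smul_le (χ.contDiff (n := 1))
    χ.hasCompactSupport
  have hinv : Tendsto (fun k : ℕ => ((k : ℝ) + 1)⁻¹) atTop (𝓝 0) := by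
    simpa [one_div] using tendsto_one_div_add_atTop_nhds_zero_nat (𝕜 := ℝ)
  refine ⟨fun k x => χ (((k : ℝ) + 1)⁻¹ • x), fun k => (M * ((k : ℝ) + 1)⁻¹).toNNReal, ?_, ?_,
    fun k => ⟨χ.contDiff.comp (contDiff_const_smul _),
      χ.hasCompactSupport.comp_smul (by positivity), fun x => ⟨?_, ?_⟩⟩⟩
  · simpa using tendsto_real_toNNReal (hinv.const_mul M)
  · intro x
    have hsmall : Tendsto (fun k : ℕ => ‖((k : ℝ) + 1)⁻¹ • x‖) atTop (𝓝 0) := by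
      simpa using (hinv.smul_const x).norm
    filter_upwards [hsmall.eventually_lt_const one_pos] with k hk
    exact χ.one_of_mem_closedBall (mem_closedBall_zero_iff.2 hk.le)
  · rw [Real.norm_of_nonneg χ.nonneg]
    exact χ.le_one
  · rw [Real.coe_toNNReal _ (by positivity)]
    exact hM _ (by positivity) x

theorem eLpNorm_gradient_mul_le [InnerProductSpace ℝ F] [CompleteSpace F] [MeasurableSpace F]
    [BorelSpace F] {ν : Measure F} {p : ℝ≥0∞} (hp : 1 ≤ p) {c w : F → ℝ} (hc : ContDiff ℝ 1 c)
    (hw : ContDiff ℝ 1 w) {ε : ℝ≥0}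
    (hc_le : ∀ x, ‖c x‖ ≤ 1 ∧ ‖fderiv ℝ c x‖ ≤ ε) :
    eLpNorm (gradient fun x => c x * w x) p ν ≤
      eLpNorm (gradient w) p ν + ε * eLpNorm w p ν := by
  have hpointwise : ∀ x, ‖gradient (fun x => c x * w x) x‖ ≤
      ‖‖gradient w x‖ + (ε : ℝ) • ‖w x‖‖ := by
    intro x
    rw [norm_gradient, fderiv_fun_mul hc.differentiable_one.differentiableAt
      hw.differentiable_one.differentiableAt, norm_gradient, Real.norm_of_nonneg (by positivity)]
    refine (norm_add_le _ _).trans (add_le_add ?_ ?_)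
    · rw [norm_smul]
      exact mul_le_of_le_one_left (norm_nonneg _) (hc_le x).1
    · rw [norm_smul, mul_comm, smul_eq_mul]
      exact mul_le_mul_of_nonneg_right (hc_le x).2 (norm_nonneg _)
  calc eLpNorm (gradient fun x => c x * w x) p ν
      ≤ eLpNorm (fun x => ‖gradient w x‖ + (ε : ℝ) • ‖w x‖) p ν := eLpNorm_mono hpointwise
    _ ≤ eLpNorm (fun x => ‖gradient w x‖) p ν + eLpNorm (fun x => (ε : ℝ) • ‖w x‖) p ν :=
        eLpNorm_add_le (continuous_gradient hw).norm.aestronglyMeasurable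
          (hw.continuous.norm.const_smul (ε : ℝ)).aestronglyMeasurable hp
    _ ≤ eLpNorm (gradient w) p ν + ε * eLpNorm w p ν := by
        have hsmul := eLpNorm_const_smul (ε : ℝ) (fun x => ‖w x‖) p ν
        rw [Real.enorm_of_nonneg ε.coe_nonneg, ENNReal.ofReal_coe_nnreal, eLpNorm_norm] at hsmul
        rw [eLpNorm_norm]
        exact add_le_add le_rfl hsmul.le

end Cutoff

section Sobolev

variable {n : ℕ}

theorem gradient_normed_convolution (φ : ContDiffBump (0 : Eucl n)) {u : Eucl n → ℝ}
    {g : Eucl n → Eucl n} (hu : LocallyIntegrable u volume) (hg : IsWeakGrad univ u g) :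
    gradient (φ.normed volume ⋆[ContinuousLinearMap.lsmul ℝ ℝ, volume] u) =
      φ.normed volume ⋆[ContinuousLinearMap.lsmul ℝ ℝ, volume] g := by
  ext1 x
  have hρ : ContDiff ℝ 1 (φ.normed volume) := φ.contDiff_normed
  have hψ : IsTestFun univ (fun y => φ.normed volume (x - y)) :=
    ⟨φ.contDiff_normed.comp (contDiff_const.sub contDiff_id),
      φ.hasCompactSupport_normed.comp_homeomorph (Homeomorph.subLeft x), subset_univ _⟩
  have hgrad : ∀ y, gradient (fun y => φ.normed volume (x - y)) y =
      -(gradient (φ.normed volume) (x - y)) := fun y => by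
    have hfderiv := (hρ.differentiable one_ne_zero (x - y)).hasFDerivAt.comp y
      ((hasFDerivAt_id y).const_sub x)
    rw [gradient, gradient, ← map_neg, ← (fderiv ℝ (φ.normed volume) (x - y)).comp_id,
      ← ContinuousLinearMap.comp_neg]
    exact congrArg _ hfderiv.fderiv
  have hweak := hg.integral_eq _ hψ
  simp only [hgrad, smul_neg, Measure.restrict_univ, integral_neg, neg_inj] at hweak
  have hprecomp : ∀ y, (ContinuousLinearMap.precompL (Eucl n) (ContinuousLinearMap.lsmul ℝ ℝ))
      (fderiv ℝ (φ.normed volume) (x - y)) (u y) = u y • fderiv ℝ (φ.normed volume) (x - y) :=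
    fun y => by
      ext v
      simp [mul_comm]
  rw [convolution_lsmul_swap, ← hweak, gradient,
    (φ.hasCompactSupport_normed.hasFDerivAt_convolution_left
      (ContinuousLinearMap.lsmul ℝ ℝ) hρ hu x).fderiv, convolution_eq_swap,
    ← LinearIsometryEquiv.coe_toContinuousLinearEquiv, ← ContinuousLinearEquiv.integral_comp_comm]
  exact integral_congr_ae (Eventually.of_forall fun y => by simp only [hprecomp, map_smul]; rfl)

theorem exists_contDiff_approximation {u : Eucl n → ℝ} (hu : MemH1 univ u) :
    ∃ w : ℕ → Eucl n → ℝ, (∀ k, ContDiff ℝ 1 (w k) ∧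
      eLpNorm (w k) 2 volume ≤ eLpNorm u 2 volume ∧
      eLpNorm (gradient (w k)) 2 volume ≤ eLpNorm (weakGrad univ u) 2 volume) ∧
      ∀ᵐ x, Tendsto (fun k => w k x) atTop (𝓝 (u x)) := by
  have hu_memLp : MemLp u 2 volume := by simpa using hu.1
  have hg_memLp : MemLp (weakGrad univ u) 2 volume := by simpa using hu.isWeakGrad.memLp
  have hu_loc : LocallyIntegrable u volume := hu_memLp.locallyIntegrable one_le_two
  let φ : ℕ → ContDiffBump (0 : Eucl n) := fun k =>
    ⟨1 / ((k : ℝ) + 1), 2 / ((k : ℝ) + 1), by positivity, by gcongr; norm_num⟩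
  refine ⟨fun k => (φ k).normed volume ⋆[ContinuousLinearMap.lsmul ℝ ℝ, volume] u,
    fun k => ⟨(φ k).hasCompactSupport_normed.contDiff_convolution_left _ (φ k).contDiff_normed
      hu_loc, eLpNorm_normed_convolution_le (φ k) hu_memLp.1 one_le_two ENNReal.ofNat_ne_top, ?_⟩,
    ContDiffBump.ae_convolution_tendsto_right_of_locallyIntegrable (K := 2) ?_ ?_ hu_loc⟩
  · rw [gradient_normed_convolution (φ k) hu_loc hu.isWeakGrad]
    exact eLpNorm_normed_convolution_le (φ k) hg_memLp.1 one_le_two ENNReal.ofNat_ne_top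
  · exact ((tendsto_const_div_atTop_nhds_zero_nat (2 : ℝ)).comp (tendsto_add_atTop_nat 1)).congr
      fun k => by simp [φ]
  · exact Eventually.of_forall fun k => (mul_one_div 2 ((k : ℝ) + 1)).ge

/-- The Sobolev exponent `2n/(n - 2)`. -/
noncomputable def sobolevExp (n : ℕ) : ℝ := 2 * n / (n - 2)

theorem sobolevExp_pos (hn : 2 < n) : 0 < sobolevExp n := by
  have : (2 : ℝ) < n := by exact_mod_cast hn
  exact div_pos (by linarith) (by linarith)

theorem exists_sobolev_of_contDiff (hn : 2 < n) :
    ∃ K : ℝ≥0, ∀ ψ : Eucl n → ℝ, ContDiff ℝ 1 ψ → HasCompactSupport ψ →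
      eLpNorm ψ (ENNReal.ofReal (sobolevExp n)) volume ≤ K * eLpNorm (gradient ψ) 2 volume := by
  have hn' : (2 : ℝ) < n := by exact_mod_cast hn
  have hexp : (((sobolevExp n).toNNReal : ℝ)⁻¹) =
      ((2 : ℝ≥0) : ℝ)⁻¹ - (finrank ℝ (Eucl n) : ℝ)⁻¹ := by
    rw [Real.coe_toNNReal _ (sobolevExp_pos hn).le, sobolevExp, finrank_euclideanSpace_fin]
    have : (n : ℝ) - 2 ≠ 0 := by linarith
    push_cast
    field_simp
  refine ⟨SNormLESNormFDerivOfEqConst ℝ (volume : Measure (Eucl n)) 2, fun ψ hψ hψ_supp => ?_⟩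
  have hgrad : eLpNorm (gradient ψ) 2 volume = eLpNorm (fderiv ℝ ψ) 2 volume :=
    eLpNorm_congr_norm_ae (Eventually.of_forall (norm_gradient ψ))
  rw [hgrad]
  exact eLpNorm_le_eLpNorm_fderiv_of_eq (volume : Measure (Eucl n)) hψ hψ_supp one_le_two
    (by simpa using by omega) hexp

/-- The Sobolev inequality `‖u‖_{2n/(n-2)} ≤ K ‖∇u‖₂` on `Ω`, for the single function `u`.
It holds with the same `K` on `H¹₀(Ω)` for every open `Ω` and on `H¹(ℝⁿ)`, so that its consequences
for the Choquard term need to be derived only once. -/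
def SobolevBound (K : ℝ≥0) (Ω : Set (Eucl n)) (u : Eucl n → ℝ) : Prop :=
  eLpNorm u (ENNReal.ofReal (sobolevExp n)) (volume.restrict Ω) ≤
    K * eLpNorm (weakGrad Ω u) 2 (volume.restrict Ω)

theorem exists_sobolevBound_of_memH1_univ (hn : 2 < n) :
    ∃ K : ℝ≥0, ∀ u : Eucl n → ℝ, MemH1 univ u → SobolevBound K univ u := by
  obtain ⟨K, hK⟩ := exists_sobolev_of_contDiff hn
  obtain ⟨c, ε, hε, hc_one, hc⟩ := exists_cutoff_sequence (F := Eucl n)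
  refine ⟨K, fun u hu => ?_⟩
  obtain ⟨w, hw, hlim⟩ := exists_contDiff_approximation hu
  have hu_top : eLpNorm u 2 volume ≠ ⊤ := by simpa using hu.1.2.ne
  have hbound : ∀ k, eLpNorm (fun x => c k x * w k x) (ENNReal.ofReal (sobolevExp n)) volume ≤
      K * (eLpNorm (weakGrad univ u) 2 volume + ε k * eLpNorm u 2 volume) := fun k => by
    obtain ⟨hck, hck_supp, hck_le⟩ := hc k
    obtain ⟨hwk, hwk_le, hwk_grad⟩ := hw k
    refine (hK _ (hck.mul hwk) hck_supp.mul_right).trans ?_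
    gcongr
    exact (eLpNorm_gradient_mul_le one_le_two hck hwk hck_le).trans (by gcongr)
  have hbound_lim : Tendsto
      (fun k => K * (eLpNorm (weakGrad univ u) 2 volume + ε k * eLpNorm u 2 volume)) atTop
      (𝓝 (K * eLpNorm (weakGrad univ u) 2 volume)) := by
    have herror : Tendsto (fun k => ε k * eLpNorm u 2 volume) atTop (𝓝 0) := by
      simpa using ENNReal.Tendsto.mul_const (ENNReal.tendsto_coe.2 hε) (Or.inr hu_top)
    simpa using ENNReal.Tendsto.const_mul
      (tendsto_const_nhds.add herror) (Or.inr ENNReal.coe_ne_top)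
  rw [SobolevBound, Measure.restrict_univ]
  refine le_of_forall_gt_imp_ge_of_dense fun B hB => Lp.eLpNorm_le_of_ae_tendsto
    (f := fun k x => c k x * w k x)
    ((hbound_lim.eventually_lt_const hB).mono fun k hk => (hbound k).trans hk.le)
    (fun k => ((hc k).1.mul (hw k).1).continuous.aestronglyMeasurable) ?_
  filter_upwards [hlim] with x hx
  exact hx.congr' ((hc_one x).mono fun k hk => by simp only [hk, one_mul])

theorem exists_sobolevBound_of_memH10 (hn : 2 < n) :
    ∃ K : ℝ≥0, ∀ (Ω : Set (Eucl n)) (u : Eucl n → ℝ), MemH10 Ω u → SobolevBound K Ω u := by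
  obtain ⟨K, hK⟩ := exists_sobolev_of_contDiff hn
  refine ⟨K, fun Ω u hu => ?_⟩
  have hε : Tendsto (fun k : ℕ => (k + 1 : ℝ≥0∞)⁻¹) atTop (𝓝 0) := by
    simpa using (tendsto_add_atTop_iff_nat 1).2 ENNReal.tendsto_inv_nat_nhds_zero
  choose ψ hψ hψu hψgrad using fun k : ℕ => hu.2 (k + 1 : ℝ≥0∞)⁻¹ (by simp)
  have hψ_meas : ∀ k, AEStronglyMeasurable (ψ k) (volume.restrict Ω) :=
    fun k => (hψ k).smooth.continuous.aestronglyMeasurable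
  have hg_meas : AEStronglyMeasurable (weakGrad Ω u) (volume.restrict Ω) :=
    hu.1.isWeakGrad.memLp.1
  have hψ_tendsto : TendstoInMeasure (volume.restrict Ω) ψ atTop u := by
    refine tendstoInMeasure_of_tendsto_eLpNorm two_ne_zero hψ_meas hu.1.1.1 ?_
    refine tendsto_of_tendsto_of_tendsto_of_le_of_le tendsto_const_nhds hε (fun k => bot_le)
      fun k => ?_
    rw [eLpNorm_sub_comm]
    exact (hψu k).le
  have hbound : ∀ k : ℕ, eLpNorm (ψ k) (ENNReal.ofReal (sobolevExp n)) (volume.restrict Ω) ≤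
      K * (eLpNorm (weakGrad Ω u) 2 (volume.restrict Ω) + (k + 1 : ℝ≥0∞)⁻¹) := fun k => by
    have hgψ_meas : AEStronglyMeasurable (gradient (ψ k)) (volume.restrict Ω) :=
      (continuous_gradient (hψ k).contDiff_one).aestronglyMeasurable
    have hsplit : gradient (ψ k) = weakGrad Ω u - fun x => weakGrad Ω u x - gradient (ψ k) x := by
      ext1 x
      simp
    rw [(hψ k).eLpNorm_restrict]
    refine (hK _ (hψ k).contDiff_one (hψ k).compactSupport).trans ?_
    rw [← (hψ k).eLpNorm_gradient_restrict, hsplit]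
    gcongr
    exact (eLpNorm_sub_le hg_meas (hg_meas.sub hgψ_meas) one_le_two).trans
      (by gcongr; exact (hψgrad k).le)
  have hbound_lim : Tendsto
      (fun k : ℕ => K * (eLpNorm (weakGrad Ω u) 2 (volume.restrict Ω) + (k + 1 : ℝ≥0∞)⁻¹)) atTop
      (𝓝 (K * eLpNorm (weakGrad Ω u) 2 (volume.restrict Ω))) := by
    simpa using ENNReal.Tendsto.const_mul (tendsto_const_nhds.add hε) (Or.inr ENNReal.coe_ne_top)
  exact le_of_forall_gt_imp_ge_of_dense fun B hB => eLpNorm_le_of_tendstoInMeasure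
    ((hbound_lim.eventually_lt_const hB).mono fun k hk => (hbound k).trans hk.le)
    hψ_tendsto hψ_meas

end Sobolev

section ChoquardTerm

theorem lintegral_enorm_rpow_eq_eLpNorm_rpow {α V : Type*} [MeasurableSpace α]
    [NormedAddCommGroup V] {ν : Measure α} (f : α → V) {r : ℝ} (hr : 0 < r) :
    ∫⁻ x, ‖f x‖ₑ ^ r ∂ν = eLpNorm f (ENNReal.ofReal r) ν ^ r := by
  rw [eLpNorm_eq_lintegral_rpow_enorm_toReal (by simpa using hr) ENNReal.ofReal_ne_top,
    ENNReal.toReal_ofReal hr.le, ← ENNReal.rpow_mul, one_div_mul_cancel hr.ne', ENNReal.rpow_one]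

variable {n : ℕ} {μ : ℝ} {Ω : Set (Eucl n)} {u : Eucl n → ℝ}

theorem one_lt_critExp (hn : 2 < n) (hμn : μ < n) : 1 < critExp n μ := by
  have : (2 : ℝ) < n := by exact_mod_cast hn
  rw [critExp, lt_div_iff₀ (by linarith)]
  linarith

theorem choquard_const_mul (μ : ℝ) (Ω : Set (Eucl n)) (u : Eucl n → ℝ) {t : ℝ} (ht : 0 < t) :
    choquard μ Ω (fun x => t * u x) =
      ENNReal.ofReal (t ^ (2 * critExp n μ)) * choquard μ Ω u := by
  rw [choquard, choquard, ← lintegral_const_mul' _ _ ENNReal.ofReal_ne_top]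
  refine lintegral_congr fun x => ?_
  rw [← lintegral_const_mul' _ _ ENNReal.ofReal_ne_top]
  refine lintegral_congr fun y => ?_
  rw [← ENNReal.ofReal_mul (by positivity), abs_mul, abs_mul, abs_of_pos ht,
    Real.mul_rpow ht.le (abs_nonneg _), Real.mul_rpow ht.le (abs_nonneg _), two_mul,
    Real.rpow_add ht]
  congr 1
  ring

theorem ofReal_mul_div_norm_rpow_le {V : Type*} [NormedAddCommGroup V] {a b p : ℝ} (hp : 0 ≤ p)
    (hμ : 0 < μ) (z : V) : ENNReal.ofReal (|a| ^ p * |b| ^ p / ‖z‖ ^ μ) ≤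
      ‖a‖ₑ ^ p * ‖b‖ₑ ^ p * ‖z‖ₑ ^ (-μ) := by
  rcases eq_or_ne z 0 with rfl | hz
  · simp [Real.zero_rpow hμ.ne']
  have hz' : 0 < ‖z‖ := norm_pos_iff.2 hz
  rw [ENNReal.ofReal_div_of_pos (by positivity), ENNReal.ofReal_mul (by positivity),
    ← ENNReal.ofReal_rpow_of_nonneg (abs_nonneg _) hp,
    ← ENNReal.ofReal_rpow_of_nonneg (abs_nonneg _) hp, ← ENNReal.ofReal_rpow_of_pos hz',
    ← Real.enorm_eq_ofReal_abs, ← Real.enorm_eq_ofReal_abs, ofReal_norm, ENNReal.rpow_neg,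
    div_eq_mul_inv]

theorem critExp_mul_eq_sobolevExp {n : ℕ} {μ : ℝ} (h : 2 * (n : ℝ) - μ ≠ 0) :
    critExp n μ * (2 * n / (2 * n - μ)) = sobolevExp n := by
  rw [critExp, sobolevExp]
  field_simp

theorem sobolevExp_mul_eq_two_mul_critExp {n : ℕ} {μ : ℝ} (h : (n : ℝ) ≠ 0) :
    sobolevExp n * ((2 * n - μ) / n) = 2 * critExp n μ := by
  rw [critExp, sobolevExp]
  field_simp

theorem exists_choquard_le_eLpNorm (hn : 2 < n) (hμ : 0 < μ) (hμn : μ < n) :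
    ∃ C : ℝ≥0, ∀ (Ω : Set (Eucl n)) (u : Eucl n → ℝ), MeasurableSet Ω →
      AEStronglyMeasurable u (volume.restrict Ω) → choquard μ Ω u ≤
        C * eLpNorm u (ENNReal.ofReal (sobolevExp n)) (volume.restrict Ω) ^
          (2 * critExp n μ) := by
  have hn' : (2 : ℝ) < n := by exact_mod_cast hn
  have hp : 0 < critExp n μ := one_pos.trans (one_lt_critExp hn hμn)
  obtain ⟨C, hC⟩ := exists_hardyLittlewoodSobolev (volume : Measure (Eucl n)) hμ
    (by rwa [finrank_euclideanSpace_fin])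
  rw [finrank_euclideanSpace_fin] at hC
  refine ⟨C, fun Ω u hΩ hu => ?_⟩
  let f : Eucl n → ℝ≥0∞ := Ω.indicator fun x => ‖u x‖ₑ ^ critExp n μ
  have hf : ∀ x ∈ Ω, ‖u x‖ₑ ^ critExp n μ = f x := fun x hx =>
    (indicator_of_mem hx fun x => ‖u x‖ₑ ^ critExp n μ).symm
  have hf_int : ∫⁻ x, f x ^ (2 * n / (2 * n - μ) : ℝ) = ∫⁻ x in Ω, ‖u x‖ₑ ^ sobolevExp n := by
    rw [← lintegral_indicator hΩ]
    refine lintegral_congr fun x => ?_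
    by_cases hx : x ∈ Ω
    · rw [← hf x hx, indicator_of_mem hx, ← ENNReal.rpow_mul,
        critExp_mul_eq_sobolevExp (by linarith)]
    · have : 0 < 2 * (n : ℝ) / (2 * n - μ) := div_pos (by linarith) (by linarith)
      simp [f, hx, this]
  calc choquard μ Ω u
      ≤ ∫⁻ x in Ω, ∫⁻ y in Ω,
          ‖u x‖ₑ ^ critExp n μ * ‖u y‖ₑ ^ critExp n μ * ‖x - y‖ₑ ^ (-μ) :=
        lintegral_mono fun x => lintegral_mono fun y => ofReal_mul_div_norm_rpow_le hp.le hμ _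
    _ = ∫⁻ x in Ω, ∫⁻ y in Ω, f x * f y * ‖x - y‖ₑ ^ (-μ) :=
        setLIntegral_congr_fun hΩ fun x hx => setLIntegral_congr_fun hΩ fun y hy => by
          simp only [hf x hx, hf y hy]
    _ ≤ ∫⁻ x, ∫⁻ y, f x * f y * ‖x - y‖ₑ ^ (-μ) :=
        (setLIntegral_le_lintegral _ _).trans
          (lintegral_mono fun x => setLIntegral_le_lintegral _ _)
    _ ≤ C * (∫⁻ x, f x ^ (2 * n / (2 * n - μ) : ℝ)) ^ ((2 * n - μ) / n : ℝ) :=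
        hC f ((aemeasurable_indicator_iff hΩ).2 (hu.enorm.pow_const _))
    _ = C * eLpNorm u (ENNReal.ofReal (sobolevExp n)) (volume.restrict Ω) ^
          (2 * critExp n μ) := by
        rw [hf_int, lintegral_enorm_rpow_eq_eLpNorm_rpow _ (sobolevExp_pos hn),
          ← ENNReal.rpow_mul, sobolevExp_mul_eq_two_mul_critExp (by linarith)]

theorem choquard_ne_zero (hn : 0 < n) (hu : AEStronglyMeasurable u (volume.restrict Ω))
    (hu_ne : ¬ ∀ᵐ x ∂volume.restrict Ω, u x = 0) : choquard μ Ω u ≠ 0 := by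
  have : Nonempty (Fin n) := ⟨⟨0, hn⟩⟩
  intro hzero
  have hu_freq : ∃ᶠ x in ae (volume.restrict Ω), u x ≠ 0 := not_eventually.1 hu_ne
  have hp : AEMeasurable (fun x => |u x| ^ critExp n μ) (volume.restrict Ω) :=
    hu.aemeasurable.abs.pow_const _
  have hinner_meas : ∀ x, AEMeasurable (fun y => ENNReal.ofReal
      (|u x| ^ critExp n μ * |u y| ^ critExp n μ / ‖x - y‖ ^ μ)) (volume.restrict Ω) := fun x =>
    ((hp.const_mul _).div
      ((measurable_const.sub measurable_id).norm.pow_const _).aemeasurable).ennreal_ofReal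
  have hmeas : AEMeasurable (fun z : Eucl n × Eucl n => ENNReal.ofReal
      (|u z.1| ^ critExp n μ * |u z.2| ^ critExp n μ / ‖z.1 - z.2‖ ^ μ))
      ((volume.restrict Ω).prod (volume.restrict Ω)) :=
    ((hp.comp_fst.mul hp.comp_snd).div
      ((measurable_fst.sub measurable_snd).norm.pow_const _).aemeasurable).ennreal_ofReal
  have houter := (lintegral_eq_zero_iff' hmeas.lintegral_prod_right').1 hzero
  obtain ⟨x, hux, hx⟩ := (hu_freq.and_eventually houter).exists
  have hinner := (lintegral_eq_zero_iff' (hinner_meas x)).1 hx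
  have hne_x : ∀ᵐ y ∂volume.restrict Ω, y ≠ x := ae_restrict_of_ae (by simp [ae_iff])
  obtain ⟨y, huy, hy, hyx⟩ := (hu_freq.and_eventually (hinner.and hne_x)).exists
  have hxy : 0 < ‖x - y‖ := norm_pos_iff.2 (sub_ne_zero.2 hyx.symm)
  have hkernel_pos : 0 < |u x| ^ critExp n μ * |u y| ^ critExp n μ / ‖x - y‖ ^ μ :=
    div_pos (mul_pos (Real.rpow_pos_of_pos (abs_pos.2 hux) _)
      (Real.rpow_pos_of_pos (abs_pos.2 huy) _)) (Real.rpow_pos_of_pos hxy _)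
  exact (ENNReal.ofReal_pos.2 hkernel_pos).ne' hy

theorem exists_choquard_le_dirichlet (hn : 2 < n) (hμ : 0 < μ) (hμn : μ < n) (K : ℝ≥0) :
    ∃ D : ℝ, 0 < D ∧ ∀ (Ω : Set (Eucl n)) (u : Eucl n → ℝ), MeasurableSet Ω → MemH1 Ω u →
      SobolevBound K Ω u → choquard μ Ω u ≤ ENNReal.ofReal (D * dirichlet Ω u ^ critExp n μ) := by
  obtain ⟨C, hC⟩ := exists_choquard_le_eLpNorm hn hμ hμn
  have hp : 0 < critExp n μ := one_pos.trans (one_lt_critExp hn hμn)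
  refine ⟨C * K ^ (2 * critExp n μ) + 1, by positivity, fun Ω u hΩ hu hK => ?_⟩
  have hd := dirichlet_nonneg Ω u
  have hK' : eLpNorm u (ENNReal.ofReal (sobolevExp n)) (volume.restrict Ω) ≤
      ENNReal.ofReal (K * dirichlet Ω u ^ (1 / 2 : ℝ)) := by
    rw [ENNReal.ofReal_mul (by positivity), ENNReal.ofReal_coe_nnreal, ← hu.eLpNorm_weakGrad]
    exact hK
  calc choquard μ Ω u
      ≤ C * ENNReal.ofReal (K * dirichlet Ω u ^ (1 / 2 : ℝ)) ^ (2 * critExp n μ) :=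
        (hC Ω u hΩ hu.1.1).trans (by gcongr)
    _ = ENNReal.ofReal (C * K ^ (2 * critExp n μ) * dirichlet Ω u ^ critExp n μ) := by
        rw [ENNReal.ofReal_rpow_of_nonneg (by positivity) (by positivity),
          ← ENNReal.ofReal_coe_nnreal, ← ENNReal.ofReal_mul (by positivity),
          Real.mul_rpow (by positivity) (by positivity), ← Real.rpow_mul hd, mul_assoc]
        ring_nf
    _ ≤ ENNReal.ofReal ((C * K ^ (2 * critExp n μ) + 1) * dirichlet Ω u ^ critExp n μ) := by
        gcongr
        linarith

theorem SobolevBound.dirichlet_pos {K : ℝ≥0} (hK : SobolevBound K Ω u) (hn : 2 < n)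
    (hu : MemH1 Ω u) (hu_ne : ¬ ∀ᵐ x ∂volume.restrict Ω, u x = 0) : 0 < dirichlet Ω u := by
  refine (dirichlet_nonneg Ω u).lt_of_ne' fun hzero => hu_ne ?_
  rw [SobolevBound, hu.eLpNorm_weakGrad, hzero, Real.zero_rpow (by norm_num), ENNReal.ofReal_zero,
    mul_zero, nonpos_iff_eq_zero,
    eLpNorm_eq_zero_iff hu.1.1 (by simpa using sobolevExp_pos hn)] at hK
  exact hK

theorem exists_integral_abs_rpow_le_dirichlet (hn : 2 < n) {r : ℝ} (hr : 0 < r)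
    (hr_le : r ≤ sobolevExp n) (hΩ : volume Ω ≠ ⊤) (K : ℝ≥0) :
    ∃ D : ℝ, 0 < D ∧ ∀ u : Eucl n → ℝ, MemH1 Ω u → SobolevBound K Ω u →
      ∫ x in Ω, |u x| ^ r ≤ D * dirichlet Ω u ^ (r / 2) := by
  have hs := sobolevExp_pos hn
  set e : ℝ := 1 / r - 1 / sobolevExp n
  have he : 0 ≤ e := sub_nonneg.2 (one_div_le_one_div_of_le hr hr_le)
  set V : ℝ := (volume Ω).toReal ^ e with hV
  have hV_eq : volume Ω ^ e = ENNReal.ofReal V := by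
    rw [hV, ← ENNReal.ofReal_rpow_of_nonneg ENNReal.toReal_nonneg he, ENNReal.ofReal_toReal hΩ]
  refine ⟨(K * V) ^ r + 1, by positivity, fun u hu hK => ?_⟩
  have hd := dirichlet_nonneg Ω u
  have hnorm : eLpNorm u (ENNReal.ofReal r) (volume.restrict Ω) ≤
      ENNReal.ofReal (K * V * dirichlet Ω u ^ (1 / 2 : ℝ)) := by
    have holder := eLpNorm_le_eLpNorm_mul_rpow_measure_univ (μ := volume.restrict Ω)
      (ENNReal.ofReal_le_ofReal hr_le) hu.1.1
    rw [ENNReal.toReal_ofReal hr.le, ENNReal.toReal_ofReal hs.le, Measure.restrict_apply_univ,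
      hV_eq] at holder
    refine holder.trans ((mul_le_mul_left hK _).trans_eq ?_)
    rw [hu.eLpNorm_weakGrad, ← ENNReal.ofReal_coe_nnreal, ← ENNReal.ofReal_mul (by positivity),
      ← ENNReal.ofReal_mul (by positivity), mul_right_comm]
  have hlint : ∫⁻ x in Ω, ENNReal.ofReal (|u x| ^ r) ≤
      ENNReal.ofReal ((K * V) ^ r * dirichlet Ω u ^ (r / 2)) := by
    simp_rw [← ENNReal.ofReal_rpow_of_nonneg (abs_nonneg _) hr.le, ← Real.enorm_eq_ofReal_abs]
    rw [lintegral_enorm_rpow_eq_eLpNorm_rpow _ hr]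
    refine (ENNReal.rpow_le_rpow hnorm hr.le).trans_eq ?_
    rw [ENNReal.ofReal_rpow_of_nonneg (by positivity) hr.le,
      Real.mul_rpow (by positivity) (by positivity), ← Real.rpow_mul hd, one_div_mul_eq_div]
  rw [integral_eq_lintegral_of_nonneg_ae (Eventually.of_forall fun x => by positivity)
    (hu.1.1.aemeasurable.abs.pow_const r).aestronglyMeasurable]
  refine (ENNReal.toReal_le_of_le_ofReal (by positivity) hlint).trans ?_
  gcongr
  linarith

theorem exists_isTestFun_nonneg (hΩ : IsOpen Ω) (hΩ_ne : Ω.Nonempty) :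
    ∃ ψ : Eucl n → ℝ, IsTestFun Ω ψ ∧ (∀ x, 0 ≤ ψ x) ∧
      ¬ ∀ᵐ x ∂volume.restrict Ω, ψ x = 0 := by
  obtain ⟨x₀, hx₀⟩ := hΩ_ne
  obtain ⟨ψ, hψ_supp, hψ_compact, hψ_smooth, hψ_range, hψ_one⟩ :=
    exists_contDiff_tsupport_subset (n := ⊤) (hΩ.mem_nhds hx₀)
  refine ⟨ψ, ⟨hψ_smooth, hψ_compact, hψ_supp⟩, fun x => (hψ_range ⟨x, rfl⟩).1, fun hzero => ?_⟩
  have hzero_on : ∀ x ∈ Ω, ψ x = 0 :=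
    (Measure.eqOn_open_of_ae_eq hzero hΩ hψ_smooth.continuous.continuousOn continuousOn_const)
  exact one_ne_zero (hψ_one.symm.trans (hzero_on x₀ hx₀))

theorem exists_memH1_univ_choquard_eq_one (hn : 2 < n) (hμ : 0 < μ) (hμn : μ < n) :
    ∃ u : Eucl n → ℝ, MemH1 univ u ∧ choquard μ univ u = 1 := by
  obtain ⟨C, hC⟩ := exists_choquard_le_eLpNorm hn hμ hμn
  have hp : 0 < critExp n μ := one_pos.trans (one_lt_critExp hn hμn)
  obtain ⟨ψ, hψ, -, hψ_ne⟩ := exists_isTestFun_nonneg (n := n) isOpen_univ univ_nonempty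
  have hψ_meas := hψ.memH1.1.1
  have hψ_top : choquard μ univ ψ ≠ ⊤ := by
    have hψ_memLp : MemLp ψ (ENNReal.ofReal (sobolevExp n)) (volume.restrict univ) :=
      (hψ.smooth.continuous.memLp_of_hasCompactSupport hψ.compactSupport).restrict _
    refine ne_top_of_le_ne_top ?_ (hC univ ψ .univ hψ_meas)
    exact ENNReal.mul_ne_top ENNReal.coe_ne_top
      (ENNReal.rpow_ne_top_of_nonneg (by positivity) hψ_memLp.2.ne)
  set c := (choquard μ univ ψ).toReal with hc
  have hc_pos : 0 < c := ENNReal.toReal_pos (choquard_ne_zero (by omega) hψ_meas hψ_ne) hψ_top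
  refine ⟨fun x => c ^ (-(1 / (2 * critExp n μ))) * ψ x, hψ.memH1.const_mul _, ?_⟩
  have hexp : -(1 / (2 * critExp n μ)) * (2 * critExp n μ) = -1 := by field_simp
  rw [choquard_const_mul _ _ _ (by positivity), ← ENNReal.ofReal_toReal hψ_top, ← hc,
    ← ENNReal.ofReal_mul (by positivity), ← Real.rpow_mul hc_pos.le, hexp, Real.rpow_neg_one,
    inv_mul_cancel₀ hc_pos.ne', ENNReal.ofReal_one]

theorem bestConst_pos (hn : 2 < n) (hμ : 0 < μ) (hμn : μ < n) : 0 < bestConst n μ := by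
  obtain ⟨K, hK⟩ := exists_sobolevBound_of_memH1_univ hn
  obtain ⟨D, hD, hle⟩ := exists_choquard_le_dirichlet hn hμ hμn K
  obtain ⟨u₀, hu₀, hu₀_one⟩ := exists_memH1_univ_choquard_eq_one hn hμ hμn
  have hp : 0 < critExp n μ := one_pos.trans (one_lt_critExp hn hμn)
  refine lt_of_lt_of_le (b := D⁻¹ ^ (critExp n μ)⁻¹) (by positivity)
    (le_csInf ⟨_, u₀, hu₀, hu₀_one, rfl⟩ ?_)
  rintro a ⟨u, hu, hu_one, rfl⟩
  have hbound := hle univ u .univ hu (hK u hu)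
  rw [hu_one, ENNReal.one_le_ofReal] at hbound
  rw [Real.rpow_inv_le_iff_of_pos (by positivity) (dirichlet_nonneg univ u) hp]
  rwa [inv_le_iff_one_le_mul₀ hD, mul_comm]

end ChoquardTerm

section Profile

/-- The function `t ↦ A t^α - C t^β` of the fibering method. With `α = 1 + q`,
`β = 2·2*_μ - 1 + q`, `A = ∫_Ω |∇u|²` and `C` the double integral of `u`, the critical points of
`φ_u` are the positive solutions of `profile α β A C t = λ ∫_Ω |u|^{1-q}`. -/
noncomputable def profile (α β A C t : ℝ) : ℝ := t ^ α * A - t ^ β * C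

variable {α β A C t : ℝ}

theorem profile_eq_rpow_mul (ht : 0 < t) :
    profile α β A C t = t ^ α * (A - t ^ (β - α) * C) := by
  rw [profile, mul_sub, ← mul_assoc, ← Real.rpow_add ht, add_sub_cancel]

theorem profile_zero (hα : α ≠ 0) (hβ : β ≠ 0) : profile α β A C 0 = 0 := by
  rw [profile, Real.zero_rpow hα, Real.zero_rpow hβ, zero_mul, zero_mul, sub_zero]

theorem continuous_profile (hα : 0 ≤ α) (hβ : 0 ≤ β) : Continuous (profile α β A C) :=
  ((Real.continuous_rpow_const hα).mul_const A).sub ((Real.continuous_rpow_const hβ).mul_const C)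

theorem hasDerivAt_profile (ht : t ≠ 0) :
    HasDerivAt (profile α β A C) (α * t ^ (α - 1) * A - β * t ^ (β - 1) * C) t :=
  ((Real.hasDerivAt_rpow_const (.inl ht)).mul_const A).sub
    ((Real.hasDerivAt_rpow_const (.inl ht)).mul_const C)

theorem profile_rpow_one_div (hA : 0 < A) (hC : 0 < C) (hαβ : α < β) :
    profile α β A C ((A / C) ^ (1 / (β - α))) = 0 := by
  rw [profile_eq_rpow_mul (by positivity), one_div,
    Real.rpow_inv_rpow (by positivity) (sub_pos.2 hαβ).ne', div_mul_cancel₀ _ hC.ne', sub_self,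
    mul_zero]

theorem lt_rpow_one_div_of_profile_pos (hC : 0 < C) (hαβ : α < β) (ht : 0 < t)
    (hpos : 0 < profile α β A C t) : t < (A / C) ^ (1 / (β - α)) := by
  rw [profile_eq_rpow_mul ht, mul_pos_iff_of_pos_left (by positivity), sub_pos] at hpos
  rw [one_div, Real.lt_rpow_inv_iff_of_pos ht.le _ (sub_pos.2 hαβ), lt_div_iff₀ hC]
  · exact hpos
  · have : 0 < A := (by positivity : 0 < t ^ (β - α) * C).trans hpos
    positivity

theorem profile_le (hA : 0 ≤ A) (hC : 0 < C) (hα : 0 ≤ α) (hαβ : α < β) (ht : 0 < t) :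
    profile α β A C t ≤ ((A / C) ^ (1 / (β - α))) ^ α * A := by
  rcases le_or_gt (profile α β A C t) 0 with hneg | hpos
  · exact hneg.trans (by positivity)
  · calc profile α β A C t ≤ t ^ α * A := sub_le_self _ (by positivity)
      _ ≤ ((A / C) ^ (1 / (β - α))) ^ α * A := by
        gcongr
        exact (lt_rpow_one_div_of_profile_pos hC hαβ ht hpos).le

theorem strictConcaveOn_profile_one (hC : 0 < C) (hβ : 1 < β) :
    StrictConcaveOn ℝ (Ici 0) (profile 1 β A C) := by
  refine ⟨convex_Ici 0, fun x hx y hy hxy a b ha hb hab => ?_⟩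
  have hpow := (strictConvexOn_rpow hβ).2 hx hy hxy ha hb hab
  simp only [smul_eq_mul, profile, Real.rpow_one] at hpow ⊢
  linear_combination C * hpow

theorem profile_eq_profile_one (hα : α ≠ 0) (ht : 0 ≤ t) :
    profile α β A C t = profile 1 (β / α) A C (t ^ α) := by
  rw [profile, profile, Real.rpow_one, ← Real.rpow_mul ht, mul_div_cancel₀ _ hα]

theorem encard_level_eq_two_of_strictConcaveOn {h : ℝ → ℝ} {a b c L : ℝ}
    (hh : StrictConcaveOn ℝ (Ici a) h) (hcont : ContinuousOn h (Icc a c)) (hab : a < b)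
    (hbc : b < c) (ha : h a < L) (hb : L < h b) (hc : h c < L) :
    {s | a < s ∧ h s = L}.encard = 2 := by
  obtain ⟨x, hx, hxL⟩ := intermediate_value_Ioo hab.le
    (hcont.mono (Icc_subset_Icc_right hbc.le)) ⟨ha, hb⟩
  obtain ⟨y, hy, hyL⟩ := intermediate_value_Ioo' hbc.le
    (hcont.mono (Icc_subset_Icc_left hab.le)) ⟨hc, hb⟩
  have hxy : x < y := hx.2.trans hy.1
  have hay : a < y := hx.1.trans hxy
  have between_ne : ∀ {r s t : ℝ}, a < r → r < s → s < t → h r = L → h t = L → h s ≠ L := by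
    intro r s t har hrs hst hr ht hs
    have hlt := hh.lt_on_openSegment (mem_Ici.2 har.le) (mem_Ici.2 (har.trans (hrs.trans hst)).le)
      (hrs.trans hst).ne (by rw [openSegment_eq_Ioo (hrs.trans hst)]; exact ⟨hrs, hst⟩)
    rw [hr, ht, hs, min_self] at hlt
    exact hlt.false
  have hset : {s | a < s ∧ h s = L} = {x, y} := by
    refine Subset.antisymm (fun s ⟨has, hsL⟩ => ?_) (pair_subset ⟨hx.1, hxL⟩ ⟨hay, hyL⟩)
    rcases lt_trichotomy s x with hsx | rfl | hxs
    · exact absurd hxL (between_ne has hsx hxy hsL hyL)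
    · exact .inl rfl
    rcases lt_trichotomy s y with hsy | rfl | hys
    · exact absurd hsL (between_ne hx.1 hxs hsy hxL hyL)
    · exact .inr rfl
    · exact absurd hyL (between_ne hx.1 hxy hys hxL hsL)
  rw [hset, encard_pair hxy.ne]

theorem encard_level_profile_one_eq_two {L s : ℝ} (hC : 0 < C) (hβ : 1 < β) (hL : 0 < L)
    (hs : 0 < s) (hLs : L < profile 1 β A C s) :
    {s | 0 < s ∧ profile 1 β A C s = L}.encard = 2 := by
  have hroot := lt_rpow_one_div_of_profile_pos hC hβ hs (hL.trans hLs)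
  have hA : 0 < A := by
    by_contra! hA
    have : profile 1 β A C s ≤ 0 :=
      sub_nonpos.2 ((mul_nonpos_of_nonneg_of_nonpos (by positivity) hA).trans (by positivity))
    linarith
  refine encard_level_eq_two_of_strictConcaveOn (strictConcaveOn_profile_one hC hβ)
    (continuous_profile zero_le_one (by linarith)).continuousOn hs hroot ?_ hLs ?_
  · rwa [profile_zero one_ne_zero (by linarith)]
  · rwa [profile_rpow_one_div hA hC hβ]

theorem encard_level_profile_eq_two {L : ℝ} (hC : 0 < C) (hα : 0 < α) (hαβ : α < β) (hL : 0 < L)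
    (ht : 0 < t) (hLt : L < profile α β A C t) :
    {t | 0 < t ∧ profile α β A C t = L}.encard = 2 := by
  -- The substitution `s = t ^ α` makes the profile strictly concave.
  have hinj : InjOn (fun t : ℝ => t ^ α) {t | 0 < t ∧ profile α β A C t = L} :=
    (Real.rpow_left_injOn hα.ne').mono fun _ ht => mem_Ici.2 ht.1.le
  have himage : (fun t : ℝ => t ^ α) '' {t | 0 < t ∧ profile α β A C t = L} =
      {s | 0 < s ∧ profile 1 (β / α) A C s = L} := by
    refine Subset.antisymm ?_ fun s ⟨hs, hsL⟩ => ⟨s ^ α⁻¹, ⟨by positivity, ?_⟩, ?_⟩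
    · rintro _ ⟨t, ⟨ht, htL⟩, rfl⟩
      exact ⟨Real.rpow_pos_of_pos ht α, by rw [← profile_eq_profile_one hα.ne' ht.le, htL]⟩
    · rw [profile_eq_profile_one hα.ne' (by positivity), Real.rpow_inv_rpow hs.le hα.ne', hsL]
    · exact Real.rpow_inv_rpow hs.le hα.ne'
  rw [← hinj.encard_image, himage]
  rw [profile_eq_profile_one hα.ne' ht.le] at hLt
  exact encard_level_profile_one_eq_two hC ((one_lt_div hα).2 hαβ) hL (by positivity) hLt

theorem profile_mul_rpow {q p τ : ℝ} (hA : 0 < A) (hτ : 0 ≤ τ) :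
    profile (1 + q) (2 * p - 1 + q) A C (τ * A ^ (-(1 / 2) : ℝ)) =
      A ^ ((1 - q) / 2) * profile (1 + q) (2 * p - 1 + q) 1 (C / A ^ p) τ := by
  have hα : A ^ ((1 - q) / 2) = A ^ (-(1 / 2) * (1 + q)) * A := by
    rw [← Real.rpow_add_one hA.ne']
    ring_nf
  have hβ : A ^ (-(1 / 2) * (2 * p - 1 + q)) = A ^ ((1 - q) / 2) / A ^ p := by
    rw [← Real.rpow_sub hA]
    ring_nf
  rw [profile, profile, Real.mul_rpow hτ (by positivity), Real.mul_rpow hτ (by positivity),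
    ← Real.rpow_mul hA.le, ← Real.rpow_mul hA.le, hβ, mul_assoc, ← hα]
  ring

theorem exists_mul_rpow_le_profile {p D : ℝ} (hp : 1 < p) (hD : 0 < D) (q : ℝ) :
    ∃ M : ℝ, 0 < M ∧ ∀ A C : ℝ, 0 < A → C ≤ D * A ^ p →
      ∃ t : ℝ, 0 < t ∧ M * A ^ ((1 - q) / 2) ≤ profile (1 + q) (2 * p - 1 + q) A C t := by
  set τ : ℝ := (2 * D)⁻¹ ^ (2 * p - 2)⁻¹ with hτ
  have hτ_pos : 0 < τ := by positivity
  have hτ_pow : τ ^ (2 * p - 1 + q - (1 + q)) * D = 1 / 2 := by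
    rw [show 2 * p - 1 + q - (1 + q) = 2 * p - 2 by ring, hτ,
      Real.rpow_inv_rpow (by positivity) (by linarith)]
    field_simp
  refine ⟨profile (1 + q) (2 * p - 1 + q) 1 D τ, ?_, fun A C hA hC =>
    ⟨τ * A ^ (-(1 / 2) : ℝ), by positivity, ?_⟩⟩
  · rw [profile_eq_rpow_mul hτ_pos, hτ_pow]
    positivity
  · rw [profile_mul_rpow hA hτ_pos.le, mul_comm]
    have : C / A ^ p ≤ D := (div_le_iff₀ (by positivity)).2 hC
    unfold profile
    gcongr

theorem rpow_one_sub_lt_of_lt_mul_rpow {k s : ℝ} (hA : 0 < A) (h : A < k * A ^ s) :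
    A ^ (1 - s) < k := by
  rwa [Real.rpow_sub hA, Real.rpow_one, div_lt_iff₀ (by positivity)]

end Profile

section Fiber

variable {n : ℕ} {μ q l : ℝ} {Ω : Set (Eucl n)} {u : Eucl n → ℝ}

theorem fiber_eq (hΩ : IsOpen Ω) (hu : MemH1 Ω u) {t : ℝ} (ht : 0 < t) :
    fiber μ q Ω l u t = 1 / 2 * (t ^ 2 * dirichlet Ω u) -
      l / (1 - q) * (t ^ (1 - q) * ∫ x in Ω, |u x| ^ (1 - q)) -
      1 / (2 * critExp n μ) * (t ^ (2 * critExp n μ) * (choquard μ Ω u).toReal) := by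
  rw [fiber, energy, dirichlet_const_mul hΩ hu, choquard_const_mul _ _ _ ht, ENNReal.toReal_mul,
    ENNReal.toReal_ofReal (by positivity)]
  simp_rw [abs_mul, abs_of_pos ht, Real.mul_rpow ht.le (abs_nonneg _)]
  rw [integral_const_mul]

theorem hasDerivAt_fiber (hq : q < 1) (hp : 0 < critExp n μ) (hΩ : IsOpen Ω) (hu : MemH1 Ω u)
    {t : ℝ} (ht : 0 < t) :
    HasDerivAt (fiber μ q Ω l u) (t ^ (-q) *
      (profile (1 + q) (2 * critExp n μ - 1 + q) (dirichlet Ω u) (choquard μ Ω u).toReal t -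
        l * ∫ x in Ω, |u x| ^ (1 - q))) t := by
  have hgrad := ((hasDerivAt_pow 2 t).mul_const (dirichlet Ω u)).const_mul (1 / 2)
  have hsing := ((Real.hasDerivAt_rpow_const (p := 1 - q) (.inl ht.ne')).mul_const
    (∫ x in Ω, |u x| ^ (1 - q))).const_mul (l / (1 - q))
  have hchoq := ((Real.hasDerivAt_rpow_const (p := 2 * critExp n μ) (.inl ht.ne')).mul_const
    (choquard μ Ω u).toReal).const_mul (1 / (2 * critExp n μ))
  have hq_ne : 1 - q ≠ 0 := by linarith
  refine (((hgrad.sub hsing).sub hchoq).congr_of_eventuallyEq ?_).congr_deriv ?_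
  · filter_upwards [eventually_gt_nhds ht] with s hs using fiber_eq hΩ hu hs
  · have hα : t ^ (-q) * t ^ (1 + q) = t := by
      rw [← Real.rpow_add ht, neg_add_eq_sub, add_sub_cancel_right, Real.rpow_one]
    have hβ : t ^ (-q) * t ^ (2 * critExp n μ - 1 + q) = t ^ (2 * critExp n μ - 1) := by
      rw [← Real.rpow_add ht, neg_add_eq_sub, add_sub_cancel_right]
    rw [profile, mul_sub, mul_sub, ← mul_assoc (t ^ (-q)) (t ^ (1 + q)),
      ← mul_assoc (t ^ (-q)) (t ^ (2 * critExp n μ - 1 + q)), hα, hβ, sub_sub_cancel_left]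
    field_simp
    ring

theorem hasDerivAt_fiber_zero_iff (hq : q < 1) (hp : 0 < critExp n μ) (hΩ : IsOpen Ω)
    (hu : MemH1 Ω u) {t : ℝ} (ht : 0 < t) :
    HasDerivAt (fiber μ q Ω l u) 0 t ↔
      profile (1 + q) (2 * critExp n μ - 1 + q) (dirichlet Ω u) (choquard μ Ω u).toReal t =
        l * ∫ x in Ω, |u x| ^ (1 - q) := by
  have hderiv := hasDerivAt_fiber (l := l) hq hp hΩ hu ht
  rw [← sub_eq_zero]
  refine ⟨fun h => ?_, fun h => by rwa [h, mul_zero] at hderiv⟩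
  exact (mul_eq_zero.1 (hderiv.unique h)).resolve_left (by positivity)

theorem critPts_eq (hq : q < 1) (hp : 0 < critExp n μ) (hΩ : IsOpen Ω) (hu : MemH1 Ω u) :
    critPts μ q Ω l u = {t | 0 < t ∧
      profile (1 + q) (2 * critExp n μ - 1 + q) (dirichlet Ω u) (choquard μ Ω u).toReal t =
        l * ∫ x in Ω, |u x| ^ (1 - q)} :=
  Set.ext fun _ => and_congr_right fun ht => hasDerivAt_fiber_zero_iff hq hp hΩ hu ht

theorem deriv_deriv_fiber_one (hq : q < 1) (hp : 0 < critExp n μ) (hΩ : IsOpen Ω)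
    (hu : MemH1 Ω u) (hcrit : HasDerivAt (fiber μ q Ω l u) 0 1) :
    deriv (deriv (fiber μ q Ω l u)) 1 = (1 + q) * dirichlet Ω u -
      (2 * critExp n μ - 1 + q) * (choquard μ Ω u).toReal := by
  have hderiv : deriv (fiber μ q Ω l u) =ᶠ[𝓝 1] fun t => t ^ (-q) *
      (profile (1 + q) (2 * critExp n μ - 1 + q) (dirichlet Ω u) (choquard μ Ω u).toReal t -
        l * ∫ x in Ω, |u x| ^ (1 - q)) := by
    filter_upwards [eventually_gt_nhds one_pos] with s hs
      using (hasDerivAt_fiber hq hp hΩ hu hs).deriv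
  rw [hderiv.deriv_eq, ((Real.hasDerivAt_rpow_const (.inl one_ne_zero)).fun_mul
    ((hasDerivAt_profile one_ne_zero).sub_const _)).deriv,
    (hasDerivAt_fiber_zero_iff hq hp hΩ hu one_pos).1 hcrit]
  simp only [Real.one_rpow, sub_self, mul_zero, zero_add, one_mul, mul_one]

theorem MemHPlus.integral_pos (hu : MemHPlus q Ω u) (hq : q < 1) :
    0 < ∫ x in Ω, |u x| ^ (1 - q) := by
  have hnonneg : 0 ≤ fun x => |u x| ^ (1 - q) := fun x => by positivity
  refine (integral_nonneg hnonneg).lt_of_ne' fun hzero => hu.ne_zero ?_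
  filter_upwards [(integral_eq_zero_iff_of_nonneg hnonneg hu.integrable).1 hzero] with x hx
  exact abs_eq_zero.1 ((Real.rpow_eq_zero (abs_nonneg _) (by linarith)).1 hx)

theorem MemHPlus.dirichlet_pos (hu : MemHPlus q Ω u) (hn : 2 < n) : 0 < dirichlet Ω u := by
  obtain ⟨K, hK⟩ := exists_sobolevBound_of_memH10 hn
  exact (hK Ω u hu.memH10).dirichlet_pos hn hu.memH10.1 hu.ne_zero

theorem MemHPlus.choquard_toReal_pos (hu : MemHPlus q Ω u) (hn : 2 < n) (hμ : 0 < μ)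
    (hμn : μ < n) (hΩ : IsOpen Ω) : 0 < (choquard μ Ω u).toReal := by
  obtain ⟨K, hK⟩ := exists_sobolevBound_of_memH10 hn
  obtain ⟨D, -, hD⟩ := exists_choquard_le_dirichlet hn hμ hμn K
  exact ENNReal.toReal_pos (choquard_ne_zero (by lia) hu.memH10.1.1.1 hu.ne_zero)
    (ne_top_of_le_ne_top ENNReal.ofReal_ne_top
      (hD Ω u hΩ.measurableSet hu.memH10.1 (hK Ω u hu.memH10)))

theorem exists_choquard_toReal_le_dirichlet (hn : 2 < n) (hμ : 0 < μ) (hμn : μ < n) :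
    ∃ D : ℝ, 0 < D ∧ ∀ (Ω : Set (Eucl n)) (u : Eucl n → ℝ), MeasurableSet Ω → MemH10 Ω u →
      (choquard μ Ω u).toReal ≤ D * dirichlet Ω u ^ critExp n μ := by
  obtain ⟨K, hK⟩ := exists_sobolevBound_of_memH10 hn
  obtain ⟨D, hD, hle⟩ := exists_choquard_le_dirichlet hn hμ hμn K
  refine ⟨D, hD, fun Ω u hΩ hu => ENNReal.toReal_le_of_le_ofReal ?_ (hle Ω u hΩ hu.1 (hK Ω u hu))⟩
  have := dirichlet_nonneg Ω u
  positivity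

theorem exists_integral_le_dirichlet (hn : 2 < n) (hq : -1 < q) (hq1 : q < 1)
    (hΩ : volume Ω ≠ ⊤) :
    ∃ E : ℝ, 0 < E ∧ ∀ u, MemH10 Ω u →
      ∫ x in Ω, |u x| ^ (1 - q) ≤ E * dirichlet Ω u ^ ((1 - q) / 2) := by
  obtain ⟨K, hK⟩ := exists_sobolevBound_of_memH10 hn
  have hexp : 1 - q ≤ sobolevExp n := by
    have : (2 : ℝ) < n := by exact_mod_cast hn
    rw [sobolevExp, le_div_iff₀ (by linarith)]
    nlinarith
  obtain ⟨E, hE, hle⟩ := exists_integral_abs_rpow_le_dirichlet hn (by linarith) hexp hΩ K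
  exact ⟨E, hE, fun u hu => hle u hu.1 (hK Ω u hu)⟩

theorem exists_memHPlus (hq : q < 1) (hΩ : IsOpen Ω) (hΩ_ne : Ω.Nonempty) :
    ∃ u, MemHPlus q Ω u := by
  obtain ⟨ψ, hψ, hψ_nonneg, hψ_ne⟩ := exists_isTestFun_nonneg hΩ hΩ_ne
  have hcont : Continuous fun x => |ψ x| ^ (1 - q) :=
    hψ.smooth.continuous.abs.rpow_const fun _ => .inr (by linarith)
  have hsupp : HasCompactSupport fun x => |ψ x| ^ (1 - q) :=
    hψ.compactSupport.comp_left (g := fun s : ℝ => |s| ^ (1 - q))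
      (by rw [abs_zero, Real.zero_rpow (by linarith)])
  exact ⟨ψ, hψ.memH10 hΩ, .of_forall hψ_nonneg, hψ_ne,
    (hcont.integrable_of_hasCompactSupport hsupp).restrict⟩

end Fiber

section Threshold

variable {n : ℕ} {μ q : ℝ} {Ω : Set (Eucl n)}

theorem exists_forall_encard_critPts_eq_two (hn : 2 < n) (hμ : 0 < μ) (hμn : μ < n)
    (hq : -1 < q) (hq1 : q < 1) (hΩ : IsOpen Ω) (hΩ_fin : volume Ω ≠ ⊤) :
    ∃ l₀ : ℝ, 0 < l₀ ∧ ∀ l, 0 < l → l < l₀ → ∀ u, MemHPlus q Ω u →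
      (critPts μ q Ω l u).encard = 2 := by
  have hp := one_lt_critExp hn hμn
  obtain ⟨D, hD, hCD⟩ := exists_choquard_toReal_le_dirichlet hn hμ hμn
  obtain ⟨E, hE, hBE⟩ := exists_integral_le_dirichlet hn hq hq1 hΩ_fin
  obtain ⟨M, hM, hprofile⟩ := exists_mul_rpow_le_profile hp hD q
  refine ⟨M / E, by positivity, fun l hl hlt u hu => ?_⟩
  have hA := hu.dirichlet_pos hn
  have hB := hu.integral_pos hq1
  obtain ⟨t, ht, hMt⟩ := hprofile _ _ hA (hCD Ω u hΩ.measurableSet hu.memH10)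
  rw [critPts_eq hq1 (by linarith) hΩ hu.memH10.1]
  refine encard_level_profile_eq_two (hu.choquard_toReal_pos hn hμ hμn hΩ) (by linarith)
    (by linarith) (by positivity) ht ?_
  calc l * ∫ x in Ω, |u x| ^ (1 - q) ≤ l * (E * dirichlet Ω u ^ ((1 - q) / 2)) := by
        gcongr
        exact hBE u hu.memH10
    _ = l * E * dirichlet Ω u ^ ((1 - q) / 2) := (mul_assoc _ _ _).symm
    _ < M * dirichlet Ω u ^ ((1 - q) / 2) := by
        gcongr
        exact (lt_div_iff₀ hE).1 hlt
    _ ≤ _ := hMt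

theorem dirichlet_lt_of_mem_nehariPlus {l : ℝ} (hp : 1 < critExp n μ) (hq : q < 1)
    (hΩ : IsOpen Ω) {u : Eucl n → ℝ} (hu : u ∈ nehariPlus μ q Ω l) :
    dirichlet Ω u < (2 * critExp n μ - 1 + q) / (2 * critExp n μ - 2) *
      (l * ∫ x in Ω, |u x| ^ (1 - q)) := by
  obtain ⟨hu, hcrit, hmin⟩ := hu
  rw [deriv_deriv_fiber_one hq (by linarith) hΩ hu.memH10.1 hcrit] at hmin
  have hnehari := (hasDerivAt_fiber_zero_iff hq (by linarith) hΩ hu.memH10.1 one_pos).1 hcrit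
  simp only [profile, Real.one_rpow, one_mul] at hnehari
  rw [div_mul_eq_mul_div, lt_div_iff₀ (by linarith), ← hnehari]
  linarith

theorem exists_forall_dirichlet_nehariPlus_le (hn : 2 < n) (hμn : μ < n) (hq : -1 < q)
    (hq1 : q < 1) (hΩ : IsOpen Ω) (hΩ_fin : volume Ω ≠ ⊤) {T : ℝ} (hT : 0 < T) :
    ∃ l₀ : ℝ, 0 < l₀ ∧ ∀ l, 0 < l → l < l₀ → ∀ u ∈ nehariPlus μ q Ω l, dirichlet Ω u ≤ T := by
  have hp := one_lt_critExp hn hμn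
  obtain ⟨E, hE, hBE⟩ := exists_integral_le_dirichlet hn hq hq1 hΩ_fin
  set c := (2 * critExp n μ - 1 + q) / (2 * critExp n μ - 2)
  have hc : 0 < c := div_pos (by linarith) (by linarith)
  refine ⟨T ^ ((1 + q) / 2) / (c * E), by positivity, fun l hl hlt u hu => ?_⟩
  have hA := hu.1.dirichlet_pos hn
  have hself : dirichlet Ω u < c * l * E * dirichlet Ω u ^ ((1 - q) / 2) :=
    calc dirichlet Ω u < c * (l * ∫ x in Ω, |u x| ^ (1 - q)) :=
          dirichlet_lt_of_mem_nehariPlus hp hq1 hΩ hu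
      _ ≤ c * (l * (E * dirichlet Ω u ^ ((1 - q) / 2))) := by
          gcongr
          exact hBE u hu.1.memH10
      _ = c * l * E * dirichlet Ω u ^ ((1 - q) / 2) := by ring
  have hpow : dirichlet Ω u ^ ((1 + q) / 2) < T ^ ((1 + q) / 2) :=
    calc dirichlet Ω u ^ ((1 + q) / 2) = dirichlet Ω u ^ (1 - (1 - q) / 2) := by ring_nf
      _ < c * l * E := rpow_one_sub_lt_of_lt_mul_rpow hA hself
      _ = l * (c * E) := by ring
      _ < T ^ ((1 + q) / 2) := (lt_div_iff₀ (by positivity)).1 hlt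
  exact ((Real.rpow_lt_rpow_iff hA.le hT.le (by linarith)).1 hpow).le

theorem admissible_nonempty (hn : 2 < n) (hμ : 0 < μ) (hμn : μ < n) (hq : -1 < q) (hq1 : q < 1)
    (hΩ : IsOpen Ω) (hΩ_fin : volume Ω ≠ ⊤) : (admissible μ q Ω).Nonempty := by
  have hp := one_lt_critExp hn hμn
  have hS := bestConst_pos hn hμ hμn
  obtain ⟨l₁, hl₁, htwo⟩ := exists_forall_encard_critPts_eq_two hn hμ hμn hq hq1 hΩ hΩ_fin
  obtain ⟨l₂, hl₂, hle⟩ := exists_forall_dirichlet_nehariPlus_le hn hμn hq hq1 hΩ hΩ_fin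
    (T := (critExp n μ * bestConst n μ ^ critExp n μ) ^ (1 / (critExp n μ - 1))) (by positivity)
  obtain ⟨l, hl, hl_lt⟩ := exists_between (lt_min hl₁ hl₂)
  refine ⟨l, hl, htwo l hl (hl_lt.trans_le (min_le_left _ _)), sSup_le ?_⟩
  rintro _ ⟨u, hu, rfl⟩
  exact EReal.coe_le_coe (hle l hl (hl_lt.trans_le (min_le_right _ _)) u hu)

theorem bddAbove_admissible (hn : 2 < n) (hμ : 0 < μ) (hμn : μ < n) (hq : -1 < q) (hq1 : q < 1)
    (hΩ : IsOpen Ω) (hΩ_ne : Ω.Nonempty) : BddAbove (admissible μ q Ω) := by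
  have hp := one_lt_critExp hn hμn
  obtain ⟨u, hu⟩ := exists_memHPlus hq1 hΩ hΩ_ne
  refine ⟨((dirichlet Ω u / (choquard μ Ω u).toReal) ^
      (1 / (2 * critExp n μ - 1 + q - (1 + q)))) ^ (1 + q) * dirichlet Ω u /
      ∫ x in Ω, |u x| ^ (1 - q), fun l hl => (le_div_iff₀ (hu.integral_pos hq1)).2 ?_⟩
  obtain ⟨t, ht⟩ : (critPts μ q Ω l u).Nonempty := by
    rw [← encard_ne_zero, hl.2.1 u hu]
    exact two_ne_zero
  rw [critPts_eq hq1 (by linarith) hΩ hu.memH10.1] at ht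
  rw [← ht.2]
  exact profile_le (hu.dirichlet_pos hn).le (hu.choquard_toReal_pos hn hμ hμn hΩ) (by linarith)
    (by linarith) ht.1

end Threshold

end Choquard

theorem mainTheorem9_general {n : ℕ} (hn : 2 < n) {μ q : ℝ} (hμ : 0 < μ) (hμn : μ < n)
    (hq : -1 < q) (hq1 : q < 1) {Ω : Set (Choquard.Eucl n)} (hΩ : IsOpen Ω)
    (hΩ_ne : Ω.Nonempty) (hΩ_fin : volume Ω ≠ ⊤) :
    IsLUB (Choquard.admissible μ q Ω) (Choquard.threshold μ q Ω) ∧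
      0 < Choquard.threshold μ q Ω := by
  have hbdd := Choquard.bddAbove_admissible hn hμ hμn hq hq1 hΩ hΩ_ne
  obtain ⟨l, hl⟩ := Choquard.admissible_nonempty hn hμ hμn hq hq1 hΩ hΩ_fin
  exact ⟨isLUB_csSup ⟨l, hl⟩ hbdd, hl.1.trans_le (le_csSup hbdd hl)⟩

theorem mainTheorem9 (n : ℕ) (hn : 2 < n) (μ q : ℝ) (hμ : 0 < μ) (hμn : μ < n)
    (hq : 0 < q) (hq1 : q < 1) (Ω : Set (Choquard.Eucl n)) (hΩ_open : IsOpen Ω)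
    (hΩ_conn : IsConnected Ω) (hΩ_bdd : Bornology.IsBounded Ω) :
    IsLUB (Choquard.admissible μ q Ω) (Choquard.threshold μ q Ω) ∧
      0 < Choquard.threshold μ q Ω :=
  mainTheorem9_general hn hμ hμn (by linarith) hq1 hΩ_open hΩ_conn.nonempty
    hΩ_bdd.measure_lt_top.ne
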